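/- Let $n\ge 1$ and $m>0$. On $\mathbb R^{1+n}$ use light-cone coordinates $\tilde x=(x^+,x_\perp,x^-)$, with $x_\perp\in\mathbb R^{n-1}$, the bilinear form $\langle\tilde x,\tilde y\rangle_{\mathbb L}=x^+y^-+x^-y^+-x_\perp\cdot y_\perp$, $\tilde p^2=\langle\tilde p,\tilde p\rangle_{\mathbb L}$, the operator $\widetilde\Box=2\partial_+\partial_--\sum_{i=1}^{n-1}\partial_i^2$, and the Fourier transform $(\mathcal F_{\mathbb L}f)(\tilde p)=\int f(\tilde x)e^{i\langle\tilde x,\tilde p\rangle_{\mathbb L}}\,d\tilde x$ on $\mathcal S(\mathbb R^{1+n})$, extended to $\mathcal S'(\mathbb R^{1+n})$ by $(\mathcal F_{\mathbb L}u,f)=(u,\mathcal F_{\mathbb L}f)$. Let $\mathcal S_{p^+}(\mathbb R^n)$ be the space of all $f\in C^\infty(\mathbb R^n,\mathbb C)$, in the variable $\tilde{\mathbf p}=(p^+,p_\perp)$, such that $\sup_{p^+\ne0}|(p^+)^kp_\perp^\beta\partial^\alpha f(\tilde{\mathbf p})|<\infty$ for all $k\in\mathbb Z$ and all multi-indices $\alpha,\beta$,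 with the locally convex topology defined by these seminorms, and let $\mathcal S'_{p^+}(\mathbb R^n)$ be its dual (the squeezed generalized functions). Let $\mathcal S'_{p^+>0}(\mathbb R^n)$ (resp. $\mathcal S'_{p^+<0}(\mathbb R^n)$) be the subspace of those $b\in\mathcal S'_{p^+}(\mathbb R^n)$ that vanish on every $f\in\mathcal S_{p^+}(\mathbb R^n)$ with $f=0$ on $\{p^+>0\}$ (resp. on $\{p^+<0\}$). With $\widetilde\Omega(\tilde{\mathbf p})=\bigl(\tilde{\mathbf p},\tfrac{p_\perp^2+m^2}{2p^+}\bigr)$ and $\Theta$ the Heaviside function, define for $b\in\mathcal S'_{p^+}(\mathbb R^n)$ the tempered distributions $b\,\delta(\tilde p^2-m^2)$ and $b\,\delta_\pm(\tilde p^2-m^2)$ on $\mathbb R^{1+n}$ by $$(b\,\delta(\tilde p^2-m^2),f)=\Bigl(b,\tfrac{1}{2|p^+|}f(\widetilde\Omega(\tilde{\mathbf p}))\Bigr),\qquad (b\,\delta_\pm(\tilde p^2-m^2),f)=\Bigl(b,\tfrac{\Theta(\pm p^+)}{2|p^+|}f(\widetilde\Omega(\tilde{\mathbf p}))\Bigr)\qquad(f\in\mathcal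 S(\mathbb R^{1+n})),$$ where the functions on the right are extended by $0$ to $\{p^+=0\}$. Then: 1. For every $u\in\mathcal S'(\mathbb R^{1+n})$ with $(\widetilde\Box+m^2)u=0$ there is a unique $b\in\mathcal S'_{p^+}(\mathbb R^n)$ such that $u=\mathcal F_{\mathbb L}^{-1}\bigl(b\,\delta(\tilde p^2-m^2)\bigr)$. 2. The general solution of the division problem $(\tilde p^2-m^2)\tilde u=0$ in $\mathcal S'(\mathbb R^{1+n})$ is $\tilde u=b_+\,\delta_+(\tilde p^2-m^2)+b_-\,\delta_-(\tilde p^2-m^2)$ with $b_+\in\mathcal S'_{p^+>0}(\mathbb R^n)$ and $b_-\in\mathcal S'_{p^+<0}(\mathbb R^n)$; that is, $\tilde u\in\mathcal S'(\mathbb R^{1+n})$ solves it if and only if it has this form. 3. Equivalently, the general solution is $\tilde u=b\,\delta(\tilde p^2-m^2)$ with $b\in\mathcal S'_{p^+}(\mathbb R^n)$; that is, $\tilde u\in\mathcal S'(\mathbb R^{1+n})$ solves the division problem if and only if it has this form. -/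

import Mathlib

open scoped SchwartzMap LineDeriv ContDiff FourierTransform

noncomputable section

namespace LightCone

/-! ## Light-cone coordinates

Points of `ℝ^{1+n}` are `x = (x^+, x_⊥, x^-)`, with `x^+ = x 0` and `x^- = x (Fin.last n)`; momenta
are `p = (p^+, p_⊥, p^-)`, with `p^+ = p 0` and `p^- = p (Fin.last n)`.  Points of `ℝ^n` (spatial
momenta) are `(p^+, p_⊥)`, with `p^+ = p 0`.  In both cases `p_⊥` consists of the coordinates with
the indices `i : Fin n`, `i ≠ 0`. -/

/-- `ℝ^k` with its Euclidean norm and Lebesgue measure. -/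
abbrev Space (k : ℕ) : Type := EuclideanSpace ℝ (Fin k)

/-- The light-cone bilinear form `⟨x, y⟩_L = x^+ y^- + x^- y^+ - x_⊥ · y_⊥` on `ℝ^{1+n}`. -/
def lcForm {n : ℕ} [NeZero n] (x y : Space (n + 1)) : ℝ :=
  x 0 * y (Fin.last n) + x (Fin.last n) * y 0
    - ∑ i : Fin n with i ≠ 0, x i.castSucc * y i.castSucc

/-- `p_⊥² = ∑ (p_i)²` for a spatial momentum `(p^+, p_⊥) ∈ ℝ^n`. -/
def perpSq {n : ℕ} [NeZero n] (p : Space n) : ℝ := ∑ i : Fin n with i ≠ 0, p i ^ 2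

/-! ## Squeezed Schwartz functions and squeezed generalized functions -/

/-- The quantity `|p^+|^k |p_⊥|^l ‖D^j f(p)‖`, whose supremum over `p^+ ≠ 0` is the squeezed
seminorm of index `(k, l, j)`; here `k` is an integer.  As in Mathlib's `SchwartzMap`, the weight
`|p_⊥|^l` stands for all monomials `p_⊥^β` with `|β| = l`, and the norm of the `j`-th derivative
for all partial derivatives `∂^α f` with `|α| = j`. -/
def squeezedWeight {n : ℕ} [NeZero n] (k : ℤ) (l j : ℕ) (f : Space n → ℂ) (p : Space n) : ℝ :=
  |p 0| ^ k * √(perpSq p) ^ l * ‖iteratedFDeriv ℝ j f p‖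

lemma squeezedWeight_nonneg {n : ℕ} [NeZero n] (k : ℤ) (l j : ℕ) (f : Space n → ℂ)
    (p : Space n) : 0 ≤ squeezedWeight k l j f p := by
  unfold squeezedWeight; positivity

lemma squeezedWeight_add_le {n : ℕ} [NeZero n] (k : ℤ) (l j : ℕ) {f g : Space n → ℂ}
    (hf : ContDiff ℝ ∞ f) (hg : ContDiff ℝ ∞ g) (p : Space n) :
    squeezedWeight k l j (f + g) p ≤ squeezedWeight k l j f p + squeezedWeight k l j g p := by
  unfold squeezedWeight
  have hj : ((j : ℕ∞) : WithTop ℕ∞) ≤ ∞ := mod_cast le_top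
  rw [iteratedFDeriv_add_apply ((hf.of_le hj).contDiffAt) ((hg.of_le hj).contDiffAt), ← mul_add]
  gcongr
  exact norm_add_le _ _

lemma squeezedWeight_smul {n : ℕ} [NeZero n] (k : ℤ) (l j : ℕ) {f : Space n → ℂ}
    (hf : ContDiff ℝ ∞ f) (c : ℂ) (p : Space n) :
    squeezedWeight k l j (c • f) p = ‖c‖ * squeezedWeight k l j f p := by
  unfold squeezedWeight
  have hj : ((j : ℕ∞) : WithTop ℕ∞) ≤ ∞ := mod_cast le_top
  rw [iteratedFDeriv_const_smul_apply ((hf.of_le hj).contDiffAt), norm_smul]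
  ring

/-- The smooth functions on `ℝ^n` all of whose squeezed seminorms are finite, as a vector space of
functions. -/
def squeezedSubmodule (n : ℕ) [NeZero n] : Submodule ℂ (Space n → ℂ) where
  carrier := {f | ContDiff ℝ ∞ f ∧
    ∀ (k : ℤ) (l j : ℕ), ∃ C, ∀ p, p 0 ≠ 0 → squeezedWeight k l j f p ≤ C}
  zero_mem' := ⟨contDiff_const, fun k l j => ⟨0, fun p _ => by
    have : (0 : Space n → ℂ) = fun _ => (0 : ℂ) := rfl
    rw [squeezedWeight, this, iteratedFDeriv_fun_zero]; simp⟩⟩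
  add_mem' := by
    rintro f g ⟨hf, hf'⟩ ⟨hg, hg'⟩
    refine ⟨hf.add hg, fun k l j => ?_⟩
    obtain ⟨C, hC⟩ := hf' k l j
    obtain ⟨D, hD⟩ := hg' k l j
    exact ⟨C + D, fun p hp =>
      (squeezedWeight_add_le k l j hf hg p).trans (add_le_add (hC p hp) (hD p hp))⟩
  smul_mem' := by
    rintro c f ⟨hf, hf'⟩
    refine ⟨hf.const_smul c, fun k l j => ?_⟩
    obtain ⟨C, hC⟩ := hf' k l j
    refine ⟨‖c‖ * C, fun p hp => ?_⟩
    rw [squeezedWeight_smul k l j hf]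
    exact mul_le_mul_of_nonneg_left (hC p hp) (norm_nonneg c)

/-- The squeezed Schwartz space `S_{p^+}(ℝ^n)`.  (A separate type, because its topology is not the
one that `squeezedSubmodule n` has as a space of functions.) -/
def SqueezedSchwartz (n : ℕ) [NeZero n] : Type := squeezedSubmodule n

namespace SqueezedSchwartz

variable {n : ℕ} [NeZero n]

instance : AddCommGroup (SqueezedSchwartz n) := inferInstanceAs (AddCommGroup (squeezedSubmodule n))

instance : Module ℂ (SqueezedSchwartz n) := inferInstanceAs (Module ℂ (squeezedSubmodule n))

/-- The function underlying an element of `S_{p^+}(ℝ^n)`. -/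
def toFun (f : SqueezedSchwartz n) : Space n → ℂ := f.1

instance : CoeFun (SqueezedSchwartz n) (fun _ => Space n → ℂ) := ⟨toFun⟩

lemma contDiff (f : SqueezedSchwartz n) : ContDiff ℝ ∞ f := f.2.1

lemma bddAbove (f : SqueezedSchwartz n) (k : ℤ) (l j : ℕ) :
    BddAbove (Set.range fun p : {p : Space n // p 0 ≠ 0} => squeezedWeight k l j f p) := by
  obtain ⟨C, hC⟩ := f.2.2 k l j
  exact ⟨C, by rintro _ ⟨p, rfl⟩; exact hC p p.2⟩

/-- The squeezed seminorms `‖f‖_{k,l,j} = sup_{p^+ ≠ 0} |p^+|^k |p_⊥|^l ‖D^j f(p)‖`. -/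
def seminorm (n : ℕ) [NeZero n] (k : ℤ) (l j : ℕ) : Seminorm ℂ (SqueezedSchwartz n) :=
  Seminorm.of (fun f => ⨆ p : {p : Space n // p 0 ≠ 0}, squeezedWeight k l j f p)
    (fun f g => Real.iSup_le
      (fun p => (squeezedWeight_add_le k l j f.contDiff g.contDiff p).trans
        (add_le_add (le_ciSup (f.bddAbove k l j) p) (le_ciSup (g.bddAbove k l j) p)))
      (add_nonneg (Real.iSup_nonneg fun p => squeezedWeight_nonneg k l j f p)
        (Real.iSup_nonneg fun p => squeezedWeight_nonneg k l j g p)))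
    (fun c f => by
      rw [Real.mul_iSup_of_nonneg (norm_nonneg c)]
      exact congrArg _ (funext fun p => squeezedWeight_smul k l j f.contDiff c p))

/-- The family of all squeezed seminorms. -/
def seminormFamily (n : ℕ) [NeZero n] : SeminormFamily ℂ (SqueezedSchwartz n) (ℤ × ℕ × ℕ) :=
  fun i => seminorm n i.1 i.2.1 i.2.2

/-- The locally convex topology defined by the squeezed seminorms. -/
instance : TopologicalSpace (SqueezedSchwartz n) :=
  (seminormFamily n).moduleFilterBasis.topology'

lemma withSeminorms (n : ℕ) [NeZero n] : WithSeminorms (seminormFamily n) := ⟨rfl⟩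

instance : IsTopologicalAddGroup (SqueezedSchwartz n) := (withSeminorms n).topologicalAddGroup

instance : ContinuousSMul ℂ (SqueezedSchwartz n) := (withSeminorms n).continuousSMul

end SqueezedSchwartz

/-- The squeezed generalized functions `S'_{p^+}(ℝ^n)`: the continuous linear functionals on
`S_{p^+}(ℝ^n)`, with the topology of pointwise convergence. -/
abbrev SqueezedDist (n : ℕ) [NeZero n] : Type := SqueezedSchwartz n →Lₚₜ[ℂ] ℂ

/-- The positive squeezed Schwartz space `S_{p^+>0}(ℝ^n) = {f ∈ S_{p^+}(ℝ^n) : f|_{p^+<0} ≡ 0}`. -/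
def posSqueezed (n : ℕ) [NeZero n] : Submodule ℂ (SqueezedSchwartz n) where
  carrier := {f | ∀ p : Space n, p 0 < 0 → f p = 0}
  zero_mem' _ _ := rfl
  add_mem' {f g} hf hg p hp := by
    change f p + g p = 0
    rw [hf p hp, hg p hp, add_zero]
  smul_mem' c f hf p hp := by
    change c * f p = 0
    rw [hf p hp, mul_zero]

/-- The negative squeezed Schwartz space `S_{p^+<0}(ℝ^n) = {f ∈ S_{p^+}(ℝ^n) : f|_{p^+>0} ≡ 0}`. -/
def negSqueezed (n : ℕ) [NeZero n] : Submodule ℂ (SqueezedSchwartz n) where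
  carrier := {f | ∀ p : Space n, 0 < p 0 → f p = 0}
  zero_mem' _ _ := rfl
  add_mem' {f g} hf hg p hp := by
    change f p + g p = 0
    rw [hf p hp, hg p hp, add_zero]
  smul_mem' c f hf p hp := by
    change c * f p = 0
    rw [hf p hp, mul_zero]

/-- `S'_{p^+>0}(ℝ^n)`, as the subspace of those `u ∈ S'_{p^+}(ℝ^n)` that vanish on `p^+ < 0`. -/
def posSqueezedDist (n : ℕ) [NeZero n] : Submodule ℂ (SqueezedDist n) where
  carrier := {u | ∀ f ∈ negSqueezed n, u f = 0}
  zero_mem' _ _ := rfl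
  add_mem' {u v} hu hv f hf := by
    change u f + v f = 0
    rw [hu f hf, hv f hf, add_zero]
  smul_mem' c u hu f hf := by
    change c * u f = 0
    rw [hu f hf, mul_zero]

/-- `S'_{p^+<0}(ℝ^n)`, as the subspace of those `u ∈ S'_{p^+}(ℝ^n)` that vanish on `p^+ > 0`. -/
def negSqueezedDist (n : ℕ) [NeZero n] : Submodule ℂ (SqueezedDist n) where
  carrier := {u | ∀ f ∈ posSqueezed n, u f = 0}
  zero_mem' _ _ := rfl
  add_mem' {u v} hu hv f hf := by
    change u f + v f = 0
    rw [hu f hf, hv f hf, add_zero]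
  smul_mem' c u hu f hf := by
    change c * u f = 0
    rw [hu f hf, mul_zero]

/-! ## The light-cone Klein-Gordon equation, the division problem, the Fourier transform -/

/-- The light-cone d'Alembert operator `2 ∂_+ ∂_- - ∑ ∂_i²` (sum over the transverse coordinates) on
tempered distributions. -/
def lcBox {n : ℕ} [NeZero n] (u : 𝓢'(Space (n + 1), ℂ)) : 𝓢'(Space (n + 1), ℂ) :=
  (2 : ℂ) • ∂_{EuclideanSpace.single (0 : Fin (n + 1)) (1 : ℝ)}
      (∂_{EuclideanSpace.single (Fin.last n) (1 : ℝ)} u)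
    - ∑ i : Fin n with i ≠ 0,
        ∂_{EuclideanSpace.single i.castSucc (1 : ℝ)}
          (∂_{EuclideanSpace.single i.castSucc (1 : ℝ)} u)

/-- The function `p̃² - m²` on `ℝ^{1+n}`. -/
def massPoly {n : ℕ} [NeZero n] (m : ℝ) (p : Space (n + 1)) : ℂ := ((lcForm p p - m ^ 2 : ℝ) : ℂ)

/-- Multiplication by `p̃² - m²` below is genuine: this function has temperate growth. -/
lemma hasTemperateGrowth_massPoly {n : ℕ} [NeZero n] (m : ℝ) :
    (massPoly (n := n) m).HasTemperateGrowth := by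
  have hc : ∀ i : Fin (n + 1), (fun p : Space (n + 1) => p i).HasTemperateGrowth := fun i =>
    (EuclideanSpace.proj (𝕜 := ℝ) i).hasTemperateGrowth
  have hr : (fun p : Space (n + 1) => lcForm p p - m ^ 2).HasTemperateGrowth := by
    unfold lcForm
    exact ((((hc _).mul (hc _)).add ((hc _).mul (hc _))).sub
      (Function.HasTemperateGrowth.sum fun i _ => (hc _).mul (hc _))).sub (.const _)
  exact (Function.HasTemperateGrowth.comp (g := Complex.ofReal)
    Function.Complex.hasTemperateGrowth_ofReal hr :)

/-- `(p̃² - m²) v` for a tempered distribution `v`. -/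
def massMul {n : ℕ} [NeZero n] (m : ℝ) (v : 𝓢'(Space (n + 1), ℂ)) : 𝓢'(Space (n + 1), ℂ) :=
  TemperedDistribution.smulLeftCLM ℂ (massPoly m) v

/-- The involution `J` of `ℝ^{1+n}` with `⟨x, p⟩_L = x · J p` (Euclidean inner product). -/
def lcDual (n : ℕ) [NeZero n] : Space (n + 1) ≃ₗ[ℝ] Space (n + 1) :=
  LinearEquiv.ofInvolutive
    { toFun := fun p => WithLp.toLp 2 fun i =>
        if i = 0 then p (Fin.last n) else if i = Fin.last n then p 0 else - p i
      map_add' := fun p q => by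
        ext i; simp only [PiLp.add_apply]; split_ifs <;> ring
      map_smul' := fun c p => by
        ext i; simp only [PiLp.smul_apply, smul_eq_mul, RingHom.id_apply]; split_ifs <;> ring }
    (fun p => by
      have h : Fin.last n ≠ 0 := Fin.last_pos'.ne'
      ext i
      by_cases h0 : i = 0
      · subst h0; simp [h]
      · by_cases h1 : i = Fin.last n
        · subst h1; simp [h]
        · simp [h0, h1])

lemma inner_lcDual {n : ℕ} [NeZero n] (x p : Space (n + 1)) :
    inner ℝ x (lcDual n p) = lcForm x p := by
  have h : Fin.last n ≠ 0 := Fin.last_pos'.ne'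
  have key : ∀ i, (lcDual n p) i =
    if i = 0 then p (Fin.last n) else if i = Fin.last n then p 0 else - p i := fun i => rfl
  simp only [PiLp.inner_apply, key, Fin.sum_univ_castSucc, h, lcForm]
  have hs : ∀ i : Fin n, i.castSucc ≠ Fin.last n := fun i => (Fin.castSucc_lt_last i).ne
  rw [← Finset.add_sum_erase _ _ (Finset.mem_univ (0 : Fin n))]
  have he : (Finset.univ : Finset (Fin n)).erase 0 = Finset.univ.filter (· ≠ 0) := by
    ext i; simp
  rw [he, Finset.sum_congr rfl (g := fun i => - (x i.castSucc * p i.castSucc))]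
  · simp only [Finset.sum_neg_distrib, Fin.castSucc_zero', if_true, if_false, RCLike.inner_apply,
      conj_trivial]
    ring
  · intro i hi
    have : i.castSucc ≠ 0 := by
      simpa using hi
    simp [this, hs, mul_comm]

/-- The scaling `p ↦ -(2π)⁻¹ J p`, which turns the kernel `e^{-2πi x·q}` into `e^{i⟨x,p⟩_L}`. -/
def lcScale (n : ℕ) [NeZero n] : Space (n + 1) ≃L[ℝ] Space (n + 1) :=
  ((LinearEquiv.smulOfNeZero ℝ (Space (n + 1)) (-(2 * Real.pi)⁻¹)
    (neg_ne_zero.2 (inv_ne_zero Real.two_pi_pos.ne'))).trans (lcDual n)).toContinuousLinearEquiv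

/-- The Fourier transform `(F_L f)(p) = ∫ f(x) e^{i⟨x,p⟩_L} dx` as an automorphism of `𝓢(ℝ^{1+n})`;
see `lcFourier_apply` for the formula. -/
def lcFourier (n : ℕ) [NeZero n] : 𝓢(Space (n + 1), ℂ) ≃L[ℂ] 𝓢(Space (n + 1), ℂ) :=
  (FourierTransform.fourierCLE ℂ 𝓢(Space (n + 1), ℂ)).trans
    (ContinuousLinearEquiv.equivOfInverse
      (SchwartzMap.compCLMOfContinuousLinearEquiv ℂ (lcScale n))
      (SchwartzMap.compCLMOfContinuousLinearEquiv ℂ (lcScale n).symm)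
      (fun f => by ext x; simp) (fun f => by ext x; simp))

lemma lcFourier_apply {n : ℕ} [NeZero n] (f : 𝓢(Space (n + 1), ℂ)) (p : Space (n + 1)) :
    lcFourier n f p = ∫ x, f x * Complex.exp (Complex.I * (lcForm x p : ℝ)) := by
  have h1 : lcFourier n f p = (𝓕 (f : Space (n + 1) → ℂ)) (lcScale n p) := rfl
  have h2 : lcScale n p = lcDual n ((-(2 * Real.pi)⁻¹) • p) := rfl
  rw [h1, Real.fourier_eq' , h2]
  refine MeasureTheory.integral_congr_ae (Filter.Eventually.of_forall fun x => ?_)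
  have h3 : -2 * Real.pi * inner ℝ x (lcDual n ((-(2 * Real.pi)⁻¹) • p)) = lcForm x p := by
    rw [map_smul, inner_smul_right, inner_lcDual]
    field_simp
  simp only [h3, smul_eq_mul]
  rw [mul_comm, mul_comm Complex.I]

/-- The Fourier transform `F_L` on tempered distributions, `(F_L u, f) = (u, F_L f)`. -/
def lcFourierDist {n : ℕ} [NeZero n] (u : 𝓢'(Space (n + 1), ℂ)) : 𝓢'(Space (n + 1), ℂ) :=
  PointwiseConvergenceCLM.precomp ℂ (lcFourier n : 𝓢(Space (n + 1), ℂ) →L[ℂ] _) u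

/-- The inverse Fourier transform `F_L⁻¹` on tempered distributions,
`(F_L⁻¹ u, f) = (u, F_L⁻¹ f)`. -/
def lcFourierInvDist {n : ℕ} [NeZero n] (u : 𝓢'(Space (n + 1), ℂ)) : 𝓢'(Space (n + 1), ℂ) :=
  PointwiseConvergenceCLM.precomp ℂ ((lcFourier n).symm : 𝓢(Space (n + 1), ℂ) →L[ℂ] _) u



/-! ## The distributions `b δ(p̃² - m²)` and `b δ_±(p̃² - m²)` -/

/-- The light-cone energy `ω̃(p) = (p_⊥² + m²) / (2 p^+)`. -/
def lcEnergy {n : ℕ} [NeZero n] (m : ℝ) (p : Space n) : ℝ := (perpSq p + m ^ 2) / (2 * p 0)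

/-- The parametrization `Ω̃(p) = (p, ω̃(p))` of the mass shell over `{p^+ ≠ 0}`. -/
def shellPoint {n : ℕ} [NeZero n] (m : ℝ) (p : Space n) : Space (n + 1) :=
  WithLp.toLp 2 (Fin.snoc (α := fun _ => ℝ) (fun i => p i) (lcEnergy m p))

/-- The function `p ↦ θ(p^+) f(Ω̃(p)) / (2 |p^+|)`, extended by zero to `p^+ = 0`.  Here `θ` is a
function of the sign of `p^+`. -/
def onShell {n : ℕ} [NeZero n] (m : ℝ) (θ : SignType → ℝ) (f : Space (n + 1) → ℂ) (p : Space n) :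
    ℂ :=
  if p 0 = 0 then 0
  else ((θ (SignType.sign (p 0)) / (2 * |p 0|) : ℝ) : ℂ) * f (shellPoint m p)

section OnShell

/-! The following facts show that `f ↦ onShell m θ f` is a continuous linear map from `𝓢(ℝ^{1+n})`
to `S_{p^+}(ℝ^n)` when `m ≠ 0`. -/

variable {n : ℕ} [NeZero n] {F : Type} [NormedAddCommGroup F] [NormedSpace ℝ F]

/-- `p ↦ η(sign p^+) f(Ω̃(p))`, extended by zero. -/
def shellTrace (m : ℝ) (η : SignType → ℝ) (f : Space (n + 1) → F) (p : Space n) : F :=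
  if p 0 = 0 then 0 else η (SignType.sign (p 0)) • f (shellPoint m p)

/-- A function of temperate growth that equals `1 / p^+` on the mass shell. -/
def invPlus (m : ℝ) (q : Space (n + 1)) : ℝ :=
  2 * q (Fin.last n) * (∑ i : Fin n with i ≠ 0, q i.castSucc ^ 2 + m ^ 2)⁻¹

lemma shellPoint_castSucc (m : ℝ) (p : Space n) (i : Fin n) :
    shellPoint m p i.castSucc = p i := by simp [shellPoint]

lemma shellPoint_last (m : ℝ) (p : Space n) :
    shellPoint m p (Fin.last n) = lcEnergy m p := by simp [shellPoint]

lemma shellPoint_zero (m : ℝ) (p : Space n) : shellPoint m p 0 = p 0 := by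
  have := shellPoint_castSucc m p 0
  rwa [Fin.castSucc_zero'] at this

lemma perpSq_nonneg (p : Space n) : 0 ≤ perpSq p := Finset.sum_nonneg fun _ _ => sq_nonneg _

lemma perpSq_add_pos {m : ℝ} (hm : m ≠ 0) (p : Space n) : 0 < perpSq p + m ^ 2 := by
  have := perpSq_nonneg p
  positivity

lemma invPlus_shellPoint {m : ℝ} (hm : m ≠ 0) (p : Space n) :
    invPlus m (shellPoint m p) = (p 0)⁻¹ := by
  have h := (perpSq_add_pos hm p).ne'
  simp only [invPlus, shellPoint_castSucc, shellPoint_last, lcEnergy]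
  change 2 * ((perpSq p + m ^ 2) / (2 * p 0)) * (perpSq p + m ^ 2)⁻¹ = _
  by_cases h0 : p 0 = 0
  · simp [h0]
  · field_simp

lemma hasTemperateGrowth_coord {k : ℕ} (i : Fin k) :
    (fun q : Space k => q i).HasTemperateGrowth :=
  (EuclideanSpace.proj (𝕜 := ℝ) i).hasTemperateGrowth

/-- The projection `p ↦ p_⊥ / m`. -/
def perpProj (n : ℕ) [NeZero n] (m : ℝ) : Space (n + 1) →L[ℝ] Space n :=
  ∑ i : Fin n with i ≠ 0,
    (m⁻¹ • (EuclideanSpace.proj (𝕜 := ℝ) i.castSucc : Space (n + 1) →L[ℝ] ℝ)).smulRight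
      (EuclideanSpace.single i (1 : ℝ))

lemma perpProj_apply (m : ℝ) (q : Space (n + 1)) (i : Fin n) :
    perpProj n m q i = if i ≠ 0 then m⁻¹ * q i.castSucc else 0 := by
  simp [perpProj, Pi.single_apply, Finset.sum_ite_eq]

lemma hasTemperateGrowth_invPlus {m : ℝ} (hm : m ≠ 0) :
    (invPlus (n := n) m).HasTemperateGrowth := by
  have h1 : (fun q : Space (n + 1) =>
      (1 + ‖perpProj n m q‖ ^ 2) ^ (-1 : ℝ)).HasTemperateGrowth :=
    (Function.HasTemperateGrowth.comp (Function.hasTemperateGrowth_one_add_norm_sq_rpow (Space n) (-1))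
      (perpProj n m).hasTemperateGrowth :)
  have h2 : (fun q : Space (n + 1) => (2 * m⁻¹ ^ 2 * q (Fin.last n)) *
      (1 + ‖perpProj n m q‖ ^ 2) ^ (-1 : ℝ)).HasTemperateGrowth :=
    ((Function.HasTemperateGrowth.const _).mul (hasTemperateGrowth_coord _)).mul h1
  convert h2 using 1
  ext q
  have h3 : ‖perpProj n m q‖ ^ 2 = m⁻¹ ^ 2 * ∑ i : Fin n with i ≠ 0, q i.castSucc ^ 2 := by
    rw [EuclideanSpace.norm_sq_eq, Finset.mul_sum, Finset.sum_filter]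
    refine Finset.sum_congr rfl fun i _ => ?_
    rw [perpProj_apply]
    split_ifs
    · rw [Real.norm_eq_abs, sq_abs, mul_pow]
    · simp
  have h4 : 0 ≤ ∑ i : Fin n with i ≠ 0, q i.castSucc ^ 2 :=
    Finset.sum_nonneg fun _ _ => sq_nonneg _
  rw [h3, Real.rpow_neg_one, invPlus]
  have h5 : (∑ i : Fin n with i ≠ 0, q i.castSucc ^ 2) + m ^ 2 ≠ 0 := by positivity
  have h6 : 1 + m⁻¹ ^ 2 * ∑ i : Fin n with i ≠ 0, q i.castSucc ^ 2 ≠ 0 := by positivity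
  field_simp
  ring

/-- The inclusion `p ↦ (p, 0)` of `ℝ^n` in `ℝ^{1+n}`. -/
def embed (n : ℕ) : Space n →L[ℝ] Space (n + 1) :=
  ∑ i : Fin n, (EuclideanSpace.proj (𝕜 := ℝ) i : Space n →L[ℝ] ℝ).smulRight
    (EuclideanSpace.single i.castSucc (1 : ℝ))

lemma shellPoint_eq (m : ℝ) (p : Space n) :
    shellPoint m p = embed n p + lcEnergy m p • EuclideanSpace.single (Fin.last n) (1 : ℝ) := by
  ext i
  refine Fin.lastCases ?_ (fun i => ?_) i
  · simp [shellPoint_last, embed, (Fin.castSucc_lt_last _).ne']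
  · simp [shellPoint_castSucc, embed, Pi.single_apply, (Fin.castSucc_lt_last _).ne]

/-- The `i`-th rank-one operator with values in the `p^-`-direction. -/
def lastOp {n : ℕ} (i : Fin n) : Space n →L[ℝ] Space (n + 1) :=
  (EuclideanSpace.proj (𝕜 := ℝ) i : Space n →L[ℝ] ℝ).smulRight
    (EuclideanSpace.single (Fin.last n) (1 : ℝ))

/-- An operator-valued function of temperate growth, equal to the derivative of `Ω̃` on the mass
shell. -/
def shellDeriv (m : ℝ) (q : Space (n + 1)) : Space n →L[ℝ] Space (n + 1) :=
  embed n + (∑ i : Fin n with i ≠ 0, (invPlus m q * q i.castSucc) • lastOp i)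
    - (invPlus m q * q (Fin.last n)) • lastOp 0

lemma hasTemperateGrowth_shellDeriv {m : ℝ} (hm : m ≠ 0) :
    (shellDeriv (n := n) m).HasTemperateGrowth :=
  ((Function.HasTemperateGrowth.const _).add
    (Function.HasTemperateGrowth.sum fun _ _ =>
      ((hasTemperateGrowth_invPlus hm).mul (hasTemperateGrowth_coord _)).smul (.const _))).sub
    (((hasTemperateGrowth_invPlus hm).mul (hasTemperateGrowth_coord _)).smul (.const _))

lemma hasFDerivAt_lcEnergy (m : ℝ) (p : Space n) (hp : p 0 ≠ 0) :
    HasFDerivAt (lcEnergy (n := n) m)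
      ((∑ i : Fin n with i ≠ 0, ((p 0)⁻¹ * p i) •
          (EuclideanSpace.proj (𝕜 := ℝ) i : Space n →L[ℝ] ℝ))
        - ((p 0)⁻¹ * lcEnergy m p) •
          (EuclideanSpace.proj (𝕜 := ℝ) 0 : Space n →L[ℝ] ℝ)) p := by
  have hc : ∀ i : Fin n, HasFDerivAt (fun p : Space n => p i)
      (EuclideanSpace.proj (𝕜 := ℝ) i : Space n →L[ℝ] ℝ) p :=
    fun i => (EuclideanSpace.proj (𝕜 := ℝ) i : Space n →L[ℝ] ℝ).hasFDerivAt
  have h1 : HasFDerivAt (fun p : Space n => perpSq p + m ^ 2) _ p :=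
    (HasFDerivAt.fun_sum (u := Finset.univ.filter (fun i : Fin n => i ≠ 0))
      fun i _ => (hc i).pow 2).add_const (m ^ 2)
  have h2 := ((hc 0).const_mul 2)
  have h3 := h1.mul ((hasDerivAt_inv (mul_ne_zero two_ne_zero hp)).comp_hasFDerivAt p h2)
  have h5 : HasFDerivAt (lcEnergy (n := n) m) _ p := h3
  refine h5.congr_fderiv ?_
  ext v
  have h4 : ∑ i : Fin n with i ≠ 0, 2 * p i * v i = 2 * ∑ i : Fin n with i ≠ 0, p i * v i := by
    rw [Finset.mul_sum]; exact Finset.sum_congr rfl fun _ _ => by ring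
  have h6 : ∑ i : Fin n with i ≠ 0, (p 0)⁻¹ * p i * v i
      = (p 0)⁻¹ * ∑ i : Fin n with i ≠ 0, p i * v i := by
    rw [Finset.mul_sum]; exact Finset.sum_congr rfl fun _ _ => by ring
  simp only [add_apply, sub_apply, smul_apply, sum_apply, smul_eq_mul, PiLp.proj_apply, nsmul_eq_mul,
    Function.comp_apply, lcEnergy, h6, Nat.cast_ofNat, pow_one, Nat.add_one_sub_one, h4]
  field_simp
  ring

lemma hasFDerivAt_shellPoint {m : ℝ} (hm : m ≠ 0) (p : Space n) (hp : p 0 ≠ 0) :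
    HasFDerivAt (shellPoint (n := n) m) (shellDeriv m (shellPoint m p)) p := by
  have h : shellPoint (n := n) m =
      ⇑(embed n) + fun p => lcEnergy m p • EuclideanSpace.single (Fin.last n) (1 : ℝ) :=
    funext (shellPoint_eq m)
  have h1 := ((embed n).hasFDerivAt (x := p)).add
    ((hasFDerivAt_lcEnergy m p hp).smul_const (EuclideanSpace.single (Fin.last n) (1 : ℝ)))
  rw [← h] at h1
  refine h1.congr_fderiv ?_
  ext v : 1
  simp only [shellDeriv, invPlus_shellPoint hm, shellPoint_castSucc, shellPoint_last, lastOp,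
    add_apply, sub_apply, sum_apply, smul_apply, ContinuousLinearMap.smulRight_apply, smul_eq_mul,
    sub_smul, Finset.sum_smul, add_sub_assoc, smul_smul]

/-- The operator `D` on Schwartz functions with `d(f ∘ Ω̃) = (D f) ∘ Ω̃`. -/
def shellD {m : ℝ} (hm : m ≠ 0) : 𝓢(Space (n + 1), F) →L[ℝ] 𝓢(Space (n + 1), Space n →L[ℝ] F) :=
  (SchwartzMap.bilinLeftCLM (ContinuousLinearMap.compL ℝ (Space n) (Space (n + 1)) F)
    (hasTemperateGrowth_shellDeriv hm)).comp (SchwartzMap.fderivCLM ℝ (Space (n + 1)) F)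

lemma shellD_apply {m : ℝ} (hm : m ≠ 0) (f : 𝓢(Space (n + 1), F)) (q : Space (n + 1)) :
    shellD hm f q = (fderiv ℝ f q).comp (shellDeriv m q) := rfl

lemma exists_bound_sign (η : SignType → ℝ) : ∃ B, 0 ≤ B ∧ ∀ s, |η s| ≤ B :=
  ⟨∑ s, |η s|, Finset.sum_nonneg fun _ _ => abs_nonneg _, fun s =>
    Finset.single_le_sum (f := fun s => |η s|) (fun _ _ => abs_nonneg _) (Finset.mem_univ s)⟩

/-- A Schwartz function on the mass shell is controlled with all weights. -/
lemma shellTrace_bound {m : ℝ} (hm : m ≠ 0) (η : SignType → ℝ) (k : ℤ) (l : ℕ) :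
    ∃ Q : Seminorm ℝ 𝓢(Space (n + 1), F), Continuous Q ∧
      ∀ (f : 𝓢(Space (n + 1), F)) p, p 0 ≠ 0 →
      |p 0| ^ k * √(perpSq p) ^ l * ‖shellTrace m η f p‖ ≤ Q f := by
  obtain ⟨B, hB0, hB⟩ := exists_bound_sign η
  obtain ⟨g, hg, hgp⟩ : ∃ g : Space (n + 1) → ℝ, g.HasTemperateGrowth ∧
      ∀ p : Space n, p 0 ≠ 0 → g (shellPoint m p) = (p 0) ^ k := by
    rcases Int.eq_nat_or_neg k with ⟨a, rfl | rfl⟩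
    · exact ⟨fun q => q 0 ^ a, (hasTemperateGrowth_coord 0).pow a, fun p _ => by
        simp [shellPoint_zero]⟩
    · exact ⟨fun q => invPlus m q ^ a, (hasTemperateGrowth_invPlus hm).pow a, fun p _ => by
        simp [invPlus_shellPoint hm]⟩
  let h : Space (n + 1) → ℝ := fun q =>
    B * (g q * (1 + ∑ i : Fin n with i ≠ 0, q i.castSucc ^ 2) ^ l)
  have hh : h.HasTemperateGrowth :=
    (Function.HasTemperateGrowth.const B).mul (hg.mul (((Function.HasTemperateGrowth.const 1).add
      (Function.HasTemperateGrowth.sum fun i _ =>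
        (hasTemperateGrowth_coord (Fin.castSucc i)).pow 2)).pow l))
  refine ⟨(SchwartzMap.seminorm ℝ 0 0).comp (SchwartzMap.smulLeftCLM F h).toLinearMap, ?_, ?_⟩
  · exact ((schwartz_withSeminorms ℝ (Space (n + 1)) F).continuous_seminorm (0, 0)).comp
      (SchwartzMap.smulLeftCLM F h).continuous
  · intro f p hp
    refine le_trans ?_ (SchwartzMap.norm_le_seminorm ℝ (SchwartzMap.smulLeftCLM F h f)
      (shellPoint m p))
    rw [SchwartzMap.smulLeftCLM_apply_apply hh, norm_smul, shellTrace, if_neg hp, norm_smul]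
    have h1 : ‖h (shellPoint m p)‖ = B * (|p 0| ^ k * (1 + perpSq p) ^ l) := by
      simp only [h, hgp p hp, shellPoint_castSucc]
      change ‖B * ((p 0) ^ k * (1 + perpSq p) ^ l)‖ = _
      rw [norm_mul, norm_mul, norm_pow, norm_zpow, Real.norm_of_nonneg hB0, Real.norm_eq_abs,
        Real.norm_of_nonneg (by have := perpSq_nonneg p; positivity)]
    rw [h1, Real.norm_eq_abs]
    have h2 : √(perpSq p) ≤ 1 + perpSq p := by
      have h3 := Real.sq_sqrt (perpSq_nonneg p)
      nlinarith [sq_nonneg (√(perpSq p) - 1), Real.sqrt_nonneg (perpSq p)]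
    have h4 := hB (SignType.sign (p 0))
    have h5 := perpSq_nonneg p
    calc |p 0| ^ k * √(perpSq p) ^ l * (|η (SignType.sign (p 0))| * ‖f (shellPoint m p)‖)
        ≤ |p 0| ^ k * (1 + perpSq p) ^ l * (B * ‖f (shellPoint m p)‖) := by
          gcongr
      _ = _ := by ring

lemma hasFDerivAt_shellTrace {m : ℝ} (hm : m ≠ 0) (η : SignType → ℝ)
    (f : 𝓢(Space (n + 1), F)) (p : Space n) :
    HasFDerivAt (shellTrace m η f) (shellTrace m η (shellD hm f) p) p := by
  by_cases hp : p 0 = 0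
  · have h0 : shellTrace m η (shellD hm f) p = 0 := by simp [shellTrace, hp]
    rw [h0]
    obtain ⟨Q, -, hQ⟩ := shellTrace_bound (n := n) (F := F) hm η (-2) 0
    have hb : ∀ x : Space n, ‖shellTrace m η f x‖ ≤ Q f * ‖x - p‖ ^ 2 := by
      intro x
      by_cases hx : x 0 = 0
      · have : shellTrace m η f x = 0 := by simp [shellTrace, hx]
        rw [this, norm_zero]
        have := apply_nonneg Q f
        positivity
      · have h1 := hQ f x hx
        have h2 : |x 0| ≤ ‖x - p‖ := by
          have := PiLp.norm_apply_le (x - p) 0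
          simpa [hp] using this
        have h3 : 0 < |x 0| := abs_pos.2 hx
        have h4 : ‖shellTrace m η f x‖ ≤ Q f * |x 0| ^ 2 := by
          rw [pow_zero, mul_one, zpow_neg, inv_mul_le_iff₀ (zpow_pos h3 _)] at h1
          rw [mul_comm]
          exact_mod_cast h1
        refine h4.trans ?_
        have := apply_nonneg Q f
        gcongr
    have hp0 : shellTrace m η f p = 0 := by simp [shellTrace, hp]
    rw [hasFDerivAt_iff_isLittleO]
    simp only [hp0, sub_zero, zero_apply]
    refine Asymptotics.IsBigO.trans_isLittleO
      (g := fun x : Space n => ‖x - p‖ ^ 2) ?_ ?_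
    · exact Asymptotics.IsBigO.of_bound (Q f) (Filter.Eventually.of_forall fun x => by
        simpa using hb x)
    · exact Asymptotics.isLittleO_pow_sub_sub p (by norm_num)
  · have hη : ∀ᶠ x : Space n in nhds p,
        shellTrace m η f x = η (SignType.sign (p 0)) • f (shellPoint m x) := by
      have hc : Continuous fun x : Space n => x 0 := by fun_prop
      rcases lt_or_gt_of_ne hp with h | h
      · filter_upwards [(isOpen_Iio.preimage hc).mem_nhds h] with x hx
        have hx' : x 0 < 0 := hx
        simp [shellTrace, hx'.ne, sign_neg hx', sign_neg h]
      · filter_upwards [(isOpen_Ioi.preimage hc).mem_nhds h] with x hx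
        have hx' : 0 < x 0 := hx
        simp [shellTrace, hx'.ne', sign_pos hx', sign_pos h]
    have h1 := (f.hasFDerivAt (shellPoint m p)).comp p (hasFDerivAt_shellPoint hm p hp)
    refine ((h1.const_smul (η (SignType.sign (p 0)))).congr_of_eventuallyEq hη).congr_fderiv ?_
    rw [shellTrace, if_neg hp, shellD_apply]

lemma shellTrace_main {m : ℝ} (hm : m ≠ 0) (η : SignType → ℝ) (j : ℕ) :
    ∀ (F : Type) [NormedAddCommGroup F] [NormedSpace ℝ F],
      (∀ f : 𝓢(Space (n + 1), F), ContDiff ℝ j (shellTrace m η f)) ∧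
      ∀ (k : ℤ) (l : ℕ), ∃ Q : Seminorm ℝ 𝓢(Space (n + 1), F), Continuous Q ∧
      ∀ (f : 𝓢(Space (n + 1), F)) p, p 0 ≠ 0 →
        |p 0| ^ k * √(perpSq p) ^ l * ‖iteratedFDeriv ℝ j (shellTrace m η f) p‖ ≤ Q f := by
  induction j with
  | zero =>
    intro F _ _
    refine ⟨fun f => ?_, fun k l => ?_⟩
    · rw [Nat.cast_zero, contDiff_zero]
      exact continuous_iff_continuousAt.2 fun p => (hasFDerivAt_shellTrace hm η f p).continuousAt
    · simpa only [norm_iteratedFDeriv_zero] using shellTrace_bound (F := F) hm η k l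
  | succ j ih =>
    intro F _ _
    obtain ⟨ih1, ih2⟩ := ih (Space n →L[ℝ] F)
    have hd : ∀ f : 𝓢(Space (n + 1), F),
        fderiv ℝ (shellTrace m η f) = shellTrace m η (shellD hm f) :=
      fun f => funext fun p => (hasFDerivAt_shellTrace hm η f p).fderiv
    refine ⟨fun f => ?_, fun k l => ?_⟩
    · rw [Nat.cast_succ]
      exact contDiff_succ_iff_hasFDerivAt.2 ⟨_, ih1 (shellD hm f), hasFDerivAt_shellTrace hm η f⟩
    · obtain ⟨Q, hQ, hQ'⟩ := ih2 k l
      refine ⟨Q.comp (shellD hm).toLinearMap, hQ.comp (shellD hm).continuous, fun f p hp => ?_⟩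
      rw [← norm_iteratedFDeriv_fderiv, hd]
      exact hQ' (shellD hm f) p hp

lemma onShell_eq {m : ℝ} (hm : m ≠ 0) (θ : SignType → ℝ) (f : 𝓢(Space (n + 1), ℂ)) :
    onShell m θ f = shellTrace m (fun s => θ s * (s : ℝ) / 2)
      (SchwartzMap.smulLeftCLM ℂ (invPlus (n := n) m) f) := by
  ext p
  by_cases hp : p 0 = 0
  · simp [onShell, shellTrace, hp]
  · rw [onShell, shellTrace, if_neg hp, if_neg hp,
      SchwartzMap.smulLeftCLM_apply_apply (hasTemperateGrowth_invPlus hm), smul_smul,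
      invPlus_shellPoint hm, Complex.real_smul]
    congr 2
    rcases lt_or_gt_of_ne hp with h | h
    · rw [abs_of_neg h, sign_neg h]; simp; field_simp
    · rw [abs_of_pos h, sign_pos h]; simp; field_simp

lemma onShell_bound {m : ℝ} (hm : m ≠ 0) (θ : SignType → ℝ) (k : ℤ) (l j : ℕ) :
    ∃ Q : Seminorm ℝ 𝓢(Space (n + 1), ℂ), Continuous Q ∧
      ∀ (f : 𝓢(Space (n + 1), ℂ)) p, p 0 ≠ 0 → squeezedWeight k l j (onShell m θ f) p ≤ Q f := by
  obtain ⟨Q, hQ, hQ'⟩ := (shellTrace_main (n := n) hm (fun s => θ s * (s : ℝ) / 2) j ℂ).2 k l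
  refine ⟨Q.comp (SchwartzMap.smulLeftCLM ℂ (invPlus (n := n) m)).toLinearMap,
    hQ.comp (SchwartzMap.smulLeftCLM ℂ (invPlus (n := n) m)).continuous, fun f p hp => ?_⟩
  rw [onShell_eq hm]
  exact hQ' _ p hp

lemma onShell_mem {m : ℝ} (hm : m ≠ 0) (θ : SignType → ℝ) (f : 𝓢(Space (n + 1), ℂ)) :
    onShell m θ f ∈ squeezedSubmodule n := by
  refine ⟨?_, fun k l j => ?_⟩
  · rw [onShell_eq hm, contDiff_infty]
    exact fun j => (shellTrace_main hm _ j ℂ).1 _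
  · obtain ⟨Q, -, hQ⟩ := onShell_bound (n := n) hm θ k l j
    exact ⟨Q f, hQ f⟩

end OnShell

/-- The linear map `f ↦ θ(p^+) f(Ω̃(p)) / (2 |p^+|)` from `𝓢(ℝ^{1+n})` to `S_{p^+}(ℝ^n)`. -/
def onShellLM {n : ℕ} [NeZero n] {m : ℝ} (hm : m ≠ 0) (θ : SignType → ℝ) :
    𝓢(Space (n + 1), ℂ) →ₗ[ℂ] SqueezedSchwartz n where
  toFun f := ⟨onShell m θ f, onShell_mem hm θ f⟩
  map_add' f g := Subtype.ext (funext fun p => by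
    change onShell m θ (f + g) p = onShell m θ f p + onShell m θ g p
    simp only [onShell, add_apply]; split_ifs <;> ring)
  map_smul' c f := Subtype.ext (funext fun p => by
    change onShell m θ (c • f) p = c * onShell m θ f p
    simp only [onShell, smul_apply, smul_eq_mul]; split_ifs <;> ring)

/-- `onShellLM` as a continuous linear map. -/
def onShellCLM {n : ℕ} [NeZero n] {m : ℝ} (hm : m ≠ 0) (θ : SignType → ℝ) :
    𝓢(Space (n + 1), ℂ) →L[ℂ] SqueezedSchwartz n where
  toLinearMap := onShellLM hm θ
  cont := by
    refine (SqueezedSchwartz.withSeminorms n).continuous_of_continuous_comp (onShellLM hm θ) ?_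
    rintro ⟨k, l, j⟩
    obtain ⟨Q, hQ, hQ'⟩ := onShell_bound (n := n) hm θ k l j
    refine Seminorm.continuous_of_continuousAt_zero ?_
    rw [ContinuousAt, map_zero]
    have h0 : Filter.Tendsto Q (nhds 0) (nhds 0) := by
      simpa using hQ.tendsto 0
    refine squeeze_zero (fun f => apply_nonneg _ f) (fun f => ?_) h0
    exact Real.iSup_le (fun p => hQ' f p p.2) (apply_nonneg Q f)

lemma onShellCLM_apply {n : ℕ} [NeZero n] {m : ℝ} (hm : m ≠ 0) (θ : SignType → ℝ)
    (f : 𝓢(Space (n + 1), ℂ)) (p : Space n) : onShellCLM hm θ f p = onShell m θ f p := rfl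

/-- `b δ(p̃² - m²)`: the functional `f ↦ (b, f(Ω̃(p)) / (2 |p^+|))`. -/
def delta {n : ℕ} [NeZero n] {m : ℝ} (hm : m ≠ 0) (b : SqueezedDist n) : 𝓢'(Space (n + 1), ℂ) :=
  PointwiseConvergenceCLM.precomp ℂ (onShellCLM hm fun _ => 1) b

/-- `b δ_+(p̃² - m²)`: the functional `f ↦ (b, Θ(p^+) f(Ω̃(p)) / (2 |p^+|))`. -/
def deltaPos {n : ℕ} [NeZero n] {m : ℝ} (hm : m ≠ 0) (b : SqueezedDist n) :
    𝓢'(Space (n + 1), ℂ) :=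
  PointwiseConvergenceCLM.precomp ℂ (onShellCLM hm fun s => if s = 1 then 1 else 0) b

/-- `b δ_-(p̃² - m²)`: the functional `f ↦ (b, Θ(-p^+) f(Ω̃(p)) / (2 |p^+|))`. -/
def deltaNeg {n : ℕ} [NeZero n] {m : ℝ} (hm : m ≠ 0) (b : SqueezedDist n) :
    𝓢'(Space (n + 1), ℂ) :=
  PointwiseConvergenceCLM.precomp ℂ (onShellCLM hm fun s => if s = -1 then 1 else 0) b

end LightCone

end

noncomputable section

namespace LightCone

/-! ### Calculus of Schwartz functions and functions of temperate growth -/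

section Analysis

variable {D F : Type} [NormedAddCommGroup D] [NormedSpace ℝ D] [NormedAddCommGroup F]
  [NormedSpace ℝ F]

/-- Every derivative of `y⁻¹` is bounded on the open half-line `(c/2, ∞)`, which contains the range
of `h`; the composition rule for temperate growth then applies. -/
lemma hasTemperateGrowth_inv {h : D → ℝ} (hh : h.HasTemperateGrowth) {c : ℝ} (hc : 0 < c)
    (hle : ∀ x, c ≤ h x) : (fun x => (h x)⁻¹).HasTemperateGrowth := by
  refine hh.comp' (g := fun y : ℝ => y⁻¹) (t := Set.Ioi (c / 2)) ?_ isOpen_Ioi.uniqueDiffOn ?_ ?_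
  · rintro _ ⟨x, rfl⟩
    exact (half_lt_self hc).trans_le (hle x)
  · exact (contDiffOn_inv ℝ).mono fun y hy => ((half_pos hc).trans hy).ne'
  · intro N
    refine ⟨0, ∑ i ∈ Finset.range (N + 1), (i.factorial : ℝ) * ((c / 2)⁻¹) ^ (i + 1),
      by positivity, fun i hi y hy => ?_⟩
    have hy' : c / 2 < y := hy
    have hy0 : 0 < y := (half_pos hc).trans hy'
    rw [iteratedFDerivWithin_of_isOpen _ isOpen_Ioi hy, norm_iteratedFDeriv_eq_norm_iteratedDeriv,
      iteratedDeriv_eq_iterate, iter_deriv_inv, pow_zero, mul_one]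
    refine le_trans ?_ (Finset.single_le_sum (fun i _ => by positivity)
      (Finset.mem_range.2 (Nat.lt_succ_of_le hi)))
    rw [norm_mul, norm_mul, norm_pow, norm_neg, norm_one, one_pow, one_mul, norm_zpow,
      Real.norm_of_nonneg hy0.le, Real.norm_of_nonneg (Nat.cast_nonneg _)]
    have h1 : y ^ (-1 - i : ℤ) = (y⁻¹) ^ (i + 1) := by
      rw [inv_pow, ← zpow_natCast, ← zpow_neg]
      congr 1
      push_cast
      ring
    rw [h1]
    gcongr

lemma hasTemperateGrowth_ofReal {f : D → ℝ} (hf : f.HasTemperateGrowth) :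
    (fun p => (f p : ℂ)).HasTemperateGrowth :=
  (Function.Complex.hasTemperateGrowth_ofReal.comp hf :)

/-! ### Differentiation of translates -/

lemma exists_weighted_bound_translate (f : 𝓢(D, F)) (e : D) (k : ℕ) :
    ∃ C, 0 ≤ C ∧ ∀ t : ℝ, |t| ≤ 1 → ∀ x, ‖x‖ ^ k * ‖f (x + t • e)‖ ≤ C := by
  refine ⟨(1 + ‖e‖) ^ k * (2 ^ k * (Finset.Iic (k, 0)).sup (schwartzSeminormFamily ℝ D F) f),
    by positivity, fun t ht x => ?_⟩
  -- A shift by at most `‖e‖` changes polynomial weights only by a constant factor.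
  have h1 : ‖x‖ ≤ (1 + ‖e‖) * (1 + ‖x + t • e‖) := by
    have h2 : ‖x‖ ≤ ‖x + t • e‖ + ‖t • e‖ := by
      simpa using norm_sub_le (x + t • e) (t • e)
    have h3 : ‖t • e‖ ≤ ‖e‖ := by
      rw [norm_smul, Real.norm_eq_abs]
      exact mul_le_of_le_one_left (norm_nonneg _) ht
    nlinarith [norm_nonneg e, norm_nonneg (x + t • e)]
  have h4 := SchwartzMap.one_add_le_sup_seminorm_apply (𝕜 := ℝ) (m := (k, 0)) le_rfl le_rfl f
    (x + t • e)
  rw [norm_iteratedFDeriv_zero] at h4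
  change (1 + ‖x + t • e‖) ^ k * ‖f (x + t • e)‖ ≤
    2 ^ k * (Finset.Iic (k, 0)).sup (schwartzSeminormFamily ℝ D F) f at h4
  calc ‖x‖ ^ k * ‖f (x + t • e)‖ ≤ ((1 + ‖e‖) * (1 + ‖x + t • e‖)) ^ k * ‖f (x + t • e)‖ := by
        gcongr
    _ = (1 + ‖e‖) ^ k * ((1 + ‖x + t • e‖) ^ k * ‖f (x + t • e)‖) := by rw [mul_pow]; ring
    _ ≤ _ := mul_le_mul_of_nonneg_left h4 (by positivity)

lemma hasDerivAt_translate (f : 𝓢(D, F)) (e x : D) (s : ℝ) :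
    HasDerivAt (fun s : ℝ => f (x + s • e)) (∂_{e} f (x + s • e)) s := by
  have h1 : HasDerivAt (fun s : ℝ => x + s • e) e s := by
    simpa using ((hasDerivAt_id s).smul_const e).const_add x
  exact (f.hasFDerivAt (x + s • e)).comp_hasDerivAt s h1

/-- Mean value inequality in the shift parameter, with the weight `‖x‖ ^ k` frozen. -/
lemma exists_weighted_bound_translate_sub (f : 𝓢(D, F)) (e : D) (k : ℕ) :
    ∃ C, 0 ≤ C ∧ ∀ t : ℝ, |t| ≤ 1 → ∀ x, ‖x‖ ^ k * ‖f (x + t • e) - f x‖ ≤ C * |t| := by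
  obtain ⟨C, hC, h⟩ := exists_weighted_bound_translate (∂_{e} f) e k
  refine ⟨C, hC, fun t ht x => ?_⟩
  have h1 := Convex.norm_image_sub_le_of_norm_hasDerivWithin_le
    (f := fun s : ℝ => (‖x‖ ^ k) • f (x + s • e)) (C := C) (s := Set.Icc (-1) 1)
    (x := 0) (y := t) (f' := fun s => (‖x‖ ^ k) • ∂_{e} f (x + s • e))
    (fun s _ => ((hasDerivAt_translate f e x s).const_smul (‖x‖ ^ k)).hasDerivWithinAt)
    (fun s hs => by
      rw [norm_smul, norm_pow, norm_norm]
      exact h s (abs_le.2 hs) x)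
    (convex_Icc _ _) (by simp) (abs_le.1 ht)
  rw [← smul_sub, norm_smul, norm_pow, norm_norm] at h1
  simpa using h1

/-- A second use of the mean value inequality, now on `[-|t|, |t|]`, where the previous estimate for
`∂_{e} f` bounds the derivative of the remainder by `C * |t|`. -/
lemma exists_weighted_bound_translate_taylor (f : 𝓢(D, F)) (e : D) (k : ℕ) :
    ∃ C, 0 ≤ C ∧ ∀ t : ℝ, |t| ≤ 1 → ∀ x,
      ‖x‖ ^ k * ‖f (x + t • e) - f x - t • ∂_{e} f x‖ ≤ C * |t| ^ 2 := by
  obtain ⟨C, hC, h⟩ := exists_weighted_bound_translate_sub (∂_{e} f) e k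
  refine ⟨C, hC, fun t ht x => ?_⟩
  have h1 := Convex.norm_image_sub_le_of_norm_hasDerivWithin_le
    (f := fun s : ℝ => (‖x‖ ^ k) • (f (x + s • e) - s • ∂_{e} f x)) (C := C * |t|)
    (s := Set.Icc (-|t|) |t|)
    (x := 0) (y := t) (f' := fun s => (‖x‖ ^ k) • (∂_{e} f (x + s • e) - (1 : ℝ) • ∂_{e} f x))
    (fun s _ => (((hasDerivAt_translate f e x s).sub
      ((hasDerivAt_id s).smul_const (∂_{e} f x))).const_smul (‖x‖ ^ k)).hasDerivWithinAt)
    (fun s hs => by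
      rw [norm_smul, norm_pow, norm_norm, one_smul]
      exact (h s ((abs_le.2 hs).trans ht) x).trans (mul_le_mul_of_nonneg_left (abs_le.2 hs) hC))
    (convex_Icc _ _) (by simp) (abs_le.1 le_rfl)
  rw [← smul_sub, norm_smul, norm_pow, norm_norm] at h1
  simp only [zero_smul, add_zero, sub_zero, Real.norm_eq_abs] at h1
  rw [sub_right_comm, sq, ← mul_assoc]
  exact h1

/-- The second order Taylor remainder of the translates of a Schwartz function. -/
def translateRemainder (f : 𝓢(D, F)) (e : D) (t : ℝ) : 𝓢(D, F) :=
  SchwartzMap.compSubConstCLM ℝ (-(t • e)) f - f - t • ∂_{e} f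

lemma translateRemainder_apply (f : 𝓢(D, F)) (e : D) (t : ℝ) (x : D) :
    translateRemainder f e t x = f (x + t • e) - f x - t • ∂_{e} f x := by
  simp [translateRemainder, sub_neg_eq_add]

lemma fderivCLM_lineDerivOp (f : 𝓢(D, F)) (e : D) :
    SchwartzMap.fderivCLM ℝ D F (∂_{e} f) = ∂_{e} (SchwartzMap.fderivCLM ℝ D F f) := by
  ext x y
  have h2 : ContDiffAt ℝ 2 f x := f.contDiffAt 2
  have h3 : IsSymmSndFDerivAt ℝ f x := h2.isSymmSndFDerivAt (by simp)
  have hd : DifferentiableAt ℝ (fderiv ℝ f) x :=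
    (SchwartzMap.fderivCLM ℝ D F f).differentiableAt
  have h4 : fderiv ℝ (∂_{e} f : 𝓢(D, F)) x y = fderiv ℝ (fderiv ℝ f) x y e := by
    have : (⇑(∂_{e} f : 𝓢(D, F))) = fun z => fderiv ℝ f z e :=
      funext fun z => SchwartzMap.lineDerivOp_apply_eq_fderiv e f z
    rw [this, fderiv_clm_apply hd (differentiableAt_const _)]
    simp
  rw [SchwartzMap.fderivCLM_apply, h4, SchwartzMap.lineDerivOp_apply_eq_fderiv]
  exact h3 y e

lemma fderivCLM_translateRemainder (f : 𝓢(D, F)) (e : D) (t : ℝ) :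
    SchwartzMap.fderivCLM ℝ D F (translateRemainder f e t) =
      translateRemainder (SchwartzMap.fderivCLM ℝ D F f) e t := by
  rw [translateRemainder, map_sub, map_sub, map_smul, fderivCLM_lineDerivOp, translateRemainder]
  congr 2
  ext x : 1
  simp only [SchwartzMap.fderivCLM_apply, SchwartzMap.compSubConstCLM_apply]
  exact fderiv_comp_sub (-(t • e))

/-- The remainder commutes with `fderiv`, so a derivative can be moved onto `f`. The induction
ranges over all codomains because each derivative changes the codomain. -/
lemma exists_bound_translateRemainder (e : D) (k j : ℕ) :
    ∀ {F : Type} [NormedAddCommGroup F] [NormedSpace ℝ F] (f : 𝓢(D, F)),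
    ∃ C, 0 ≤ C ∧ ∀ t : ℝ, |t| ≤ 1 → ∀ x,
      ‖x‖ ^ k * ‖iteratedFDeriv ℝ j (translateRemainder f e t) x‖ ≤ C * |t| ^ 2 := by
  induction j with
  | zero =>
    intro F _ _ f
    simpa only [norm_iteratedFDeriv_zero, translateRemainder_apply] using
      exists_weighted_bound_translate_taylor f e k
  | succ j ih =>
    intro F _ _ f
    obtain ⟨C, hC, h⟩ := ih (SchwartzMap.fderivCLM ℝ D F f)
    refine ⟨C, hC, fun t ht x => ?_⟩
    rw [← norm_iteratedFDeriv_fderiv]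
    have := h t ht x
    rwa [← fderivCLM_translateRemainder] at this

/-- Each Schwartz seminorm of the Taylor remainder is O(t²), and `L` is dominated by finitely many
of them. -/
lemma hasDerivAt_apply_translate (L : 𝓢(D, ℂ) →L[ℂ] ℂ) (f : 𝓢(D, ℂ)) (e : D) :
    HasDerivAt (fun t : ℝ => L (SchwartzMap.compSubConstCLM ℝ (-(t • e)) f)) (L (∂_{e} f)) 0 := by
  obtain ⟨s, C, -, hs⟩ := Seminorm.bound_of_continuous (schwartz_withSeminorms ℂ D ℂ)
    ((normSeminorm ℂ ℂ).comp L.toLinearMap) (continuous_norm.comp L.continuous)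
  choose B hB0 hB using fun i : ℕ × ℕ => exists_bound_translateRemainder e i.1 i.2 f
  have hsup : ∀ t : ℝ, |t| ≤ 1 →
      s.sup (schwartzSeminormFamily ℂ D ℂ) (translateRemainder f e t) ≤
        (∑ i ∈ s, B i) * |t| ^ 2 := by
    intro t ht
    have h0 : 0 ≤ (∑ i ∈ s, B i) * |t| ^ 2 :=
      mul_nonneg (Finset.sum_nonneg fun i _ => hB0 i) (by positivity)
    refine Seminorm.finset_sup_apply_le h0 fun i hi => ?_
    refine SchwartzMap.seminorm_le_bound ℂ i.1 i.2 _ h0 fun x => (hB i t ht x).trans ?_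
    gcongr
    exact Finset.single_le_sum (fun i _ => hB0 i) hi
  have hL : ∀ t : ℝ, |t| ≤ 1 →
      ‖L (translateRemainder f e t)‖ ≤ C * (∑ i ∈ s, B i) * |t| ^ 2 := by
    intro t ht
    refine (hs (translateRemainder f e t)).trans ?_
    rw [mul_assoc]
    exact mul_le_mul_of_nonneg_left (hsup t ht) C.2
  rw [hasDerivAt_iff_isLittleO]
  refine Asymptotics.IsBigO.trans_isLittleO (g := fun t : ℝ => (t - 0) ^ 2) ?_ ?_
  · refine Asymptotics.IsBigO.of_bound (C * (∑ i ∈ s, B i)) ?_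
    filter_upwards [Metric.closedBall_mem_nhds (0 : ℝ) one_pos] with t ht
    rw [mem_closedBall_zero_iff, Real.norm_eq_abs] at ht
    have h1 : L (translateRemainder f e t) = L (SchwartzMap.compSubConstCLM ℝ (-(t • e)) f) -
        L f - t • L (∂_{e} f) := by
      rw [translateRemainder, map_sub, map_sub]
      congr 1
      exact (L.restrictScalars ℝ).map_smul t _
    have h2 := hL t ht
    rw [h1] at h2
    have h3 : SchwartzMap.compSubConstCLM ℝ (-((0 : ℝ) • e)) f = f := by simp
    simpa only [h3, sub_zero, norm_pow, Real.norm_eq_abs] using h2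
  · simpa using Asymptotics.isLittleO_pow_sub_sub (0 : ℝ) (m := 2) (by norm_num)

/-! ### Products with functions of temperate growth -/

/-- Leibniz rule. Decay of `H` is demanded only on the support of `g`, since all derivatives of the
product vanish elsewhere. The constants do not depend on `H`, so the estimate yields continuity of
`H ↦ H * g` as well as decay. -/
lemma exists_decay_mul {g : D → ℂ} (hg : g.HasTemperateGrowth) (k j : ℕ) :
    ∃ (N : ℕ) (C : ℝ), 0 ≤ C ∧ ∀ H : D → ℂ, ContDiff ℝ ∞ H → ∀ M, 0 ≤ M →
      (∀ x ∈ tsupport g, ∀ i ≤ j, (1 + ‖x‖) ^ N * ‖iteratedFDeriv ℝ i H x‖ ≤ M) →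
      ∀ x, ‖x‖ ^ k * ‖iteratedFDeriv ℝ j (fun y => H y * g y) x‖ ≤ C * M := by
  obtain ⟨l, C, hC, hgb⟩ := hg.norm_iteratedFDeriv_le_uniform j
  refine ⟨k + l, (∑ i ∈ Finset.range (j + 1), (j.choose i : ℝ)) * C, by positivity,
    fun H hH M hM hb x => ?_⟩
  by_cases hx : x ∈ tsupport g
  · have h1 := norm_iteratedFDeriv_mul_le (𝕜 := ℝ) hH hg.1 x (n := j) (mod_cast le_top)
    calc ‖x‖ ^ k * ‖iteratedFDeriv ℝ j (fun y => H y * g y) x‖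
        ≤ (1 + ‖x‖) ^ k * ∑ i ∈ Finset.range (j + 1), (j.choose i : ℝ) *
          ‖iteratedFDeriv ℝ i H x‖ * (C * (1 + ‖x‖) ^ l) := by
          refine mul_le_mul (pow_le_pow_left₀ (norm_nonneg _) (by simp) _)
            (h1.trans (Finset.sum_le_sum fun i _ => ?_)) (norm_nonneg _) (by positivity)
          exact mul_le_mul_of_nonneg_left (hgb _ (Nat.sub_le _ _) x) (by positivity)
      _ = ∑ i ∈ Finset.range (j + 1), (j.choose i : ℝ) * C *
          ((1 + ‖x‖) ^ (k + l) * ‖iteratedFDeriv ℝ i H x‖) := by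
          rw [Finset.mul_sum]
          exact Finset.sum_congr rfl fun i _ => by ring
      _ ≤ ∑ i ∈ Finset.range (j + 1), (j.choose i : ℝ) * C * M := by
          refine Finset.sum_le_sum fun i hi => mul_le_mul_of_nonneg_left
            (hb x hx i (Nat.lt_succ_iff.1 (Finset.mem_range.1 hi))) (by positivity)
      _ = _ := by rw [← Finset.sum_mul, ← Finset.sum_mul]
  · have h1 : iteratedFDeriv ℝ j (fun y => H y * g y) x = 0 := by
      by_contra h
      have h2 := support_iteratedFDeriv_subset (𝕜 := ℝ) j (Function.mem_support.2 h)
      exact hx (closure_mono (Function.support_mul_subset_right H g) h2)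
    rw [h1, norm_zero, mul_zero]
    positivity

lemma norm_iteratedFDeriv_comp_clm_le {E : Type} [NormedAddCommGroup E] [NormedSpace ℝ E]
    {f : E → ℂ} (hf : ContDiff ℝ ∞ f) (A : D →L[ℝ] E) (i : ℕ) (x : D) :
    ‖iteratedFDeriv ℝ i (fun y => f (A y)) x‖ ≤ ‖A‖ ^ i * ‖iteratedFDeriv ℝ i f (A x)‖ := by
  have h1 := A.iteratedFDeriv_comp_right hf x (i := i) (mod_cast le_top)
  change ‖iteratedFDeriv ℝ i (f ∘ A) x‖ ≤ _
  rw [h1, mul_comm]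
  refine (ContinuousMultilinearMap.norm_compContinuousLinearMap_le _ _).trans_eq ?_
  simp

/-! ### Slices of Schwartz functions on a product -/

/-- The Schwartz function `(τ, x) ↦ f x * β τ`, where `β` is a bump function. -/
def cutoffTensor (β : ContDiffBump (0 : ℝ)) (f : 𝓢(D, ℂ)) : 𝓢(ℝ × D, ℂ) where
  toFun x := f x.2 * ((β x.1 : ℝ) : ℂ)
  smooth' := ((f.smooth ⊤).comp contDiff_snd).mul
    (Complex.ofRealCLM.contDiff.comp (β.contDiff.comp contDiff_fst))
  decay' k j := by
    have hβ : Function.HasTemperateGrowth fun x : ℝ × D => ((β x.1 : ℝ) : ℂ) :=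
      hasTemperateGrowth_ofReal ((β.hasCompactSupport.hasTemperateGrowth β.contDiff).comp
        (ContinuousLinearMap.fst ℝ ℝ D).hasTemperateGrowth)
    obtain ⟨N, C, hC, h⟩ := exists_decay_mul hβ k j
    -- On the support of the bump the first coordinate is bounded, so the weight of the pair is
    -- controlled by `1 + ‖x.2‖` alone.
    have hb : ∀ i, ∃ M, 0 ≤ M ∧ ∀ x ∈ tsupport (fun x : ℝ × D => ((β x.1 : ℝ) : ℂ)),
        (1 + ‖x‖) ^ N * ‖iteratedFDeriv ℝ i (fun x : ℝ × D => f x.2) x‖ ≤ M := by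
      intro i
      refine ⟨(1 + β.rOut) ^ N * (‖ContinuousLinearMap.snd ℝ ℝ D‖ ^ i * (2 ^ N *
        (Finset.Iic (N, i)).sup (schwartzSeminormFamily ℝ D ℂ) f)), ?_, fun x hx => ?_⟩
      · have := β.rOut_pos
        positivity
      · have hx1 : ‖x.1‖ ≤ β.rOut := by
          have hs : tsupport (fun x : ℝ × D => ((β x.1 : ℝ) : ℂ)) ⊆
              {x : ℝ × D | ‖x.1‖ ≤ β.rOut} := by
            refine closure_minimal (fun y hy => ?_)
              (isClosed_le (by fun_prop) continuous_const)
            by_contra h'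
            refine hy ?_
            have : β y.1 = 0 := β.zero_of_le_dist (by
              rw [dist_zero_right]; exact (not_le.1 h').le)
            simp [this]
          exact hs hx
        have h2 := norm_iteratedFDeriv_comp_clm_le (f.smooth ⊤) (ContinuousLinearMap.snd ℝ ℝ D) i x
        have h3 : 1 + ‖x‖ ≤ (1 + β.rOut) * (1 + ‖x.2‖) := by
          have h4 : ‖x‖ ≤ ‖x.1‖ + ‖x.2‖ := by
            rw [Prod.norm_def]
            exact max_le_add_of_nonneg (norm_nonneg _) (norm_nonneg _)
          nlinarith [norm_nonneg x.2, β.rOut_pos]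
        have h5 := SchwartzMap.one_add_le_sup_seminorm_apply (𝕜 := ℝ) (m := (N, i)) le_rfl le_rfl f
          x.2
        have h6 := β.rOut_pos
        calc (1 + ‖x‖) ^ N * ‖iteratedFDeriv ℝ i (fun x : ℝ × D => f x.2) x‖
            ≤ ((1 + β.rOut) * (1 + ‖x.2‖)) ^ N *
              (‖ContinuousLinearMap.snd ℝ ℝ D‖ ^ i * ‖iteratedFDeriv ℝ i f x.2‖) := by
              gcongr
              exact h2
          _ = (1 + β.rOut) ^ N * (‖ContinuousLinearMap.snd ℝ ℝ D‖ ^ i *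
              ((1 + ‖x.2‖) ^ N * ‖iteratedFDeriv ℝ i f x.2‖)) := by rw [mul_pow]; ring
          _ ≤ _ := by
              refine mul_le_mul_of_nonneg_left (mul_le_mul_of_nonneg_left h5 ?_) ?_ <;> positivity
    choose M hM0 hM using hb
    refine ⟨_, h _ ((f.smooth ⊤).comp contDiff_snd) (∑ i ∈ Finset.range (j + 1), M i)
      (Finset.sum_nonneg fun i _ => hM0 i) fun x hx i hi => (hM i x hx).trans ?_⟩
    exact Finset.single_le_sum (fun i _ => hM0 i) (Finset.mem_range.2 (Nat.lt_succ_of_le hi))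

lemma cutoffTensor_apply (β : ContDiffBump (0 : ℝ)) (f : 𝓢(D, ℂ)) (x : ℝ × D) :
    cutoffTensor β f x = f x.2 * ((β x.1 : ℝ) : ℂ) := rfl

/-- Restriction of a Schwartz function on `ℝ × D` to `{τ} × D`. -/
def sliceCLM (τ : ℝ) : 𝓢(ℝ × D, ℂ) →L[ℂ] 𝓢(D, ℂ) :=
  SchwartzMap.compCLM ℂ (g := fun x : D => (τ, x))
    (by
      have h : (fun x : D => (τ, x)) = fun x => (τ, (0 : D)) + ContinuousLinearMap.inr ℝ ℝ D x := by
        ext x <;> simp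
      rw [h]
      exact (Function.HasTemperateGrowth.const _).add
        (ContinuousLinearMap.inr ℝ ℝ D).hasTemperateGrowth)
    ⟨1, 1, fun x => by
      have : ‖x‖ ≤ ‖(τ, x)‖ := by rw [Prod.norm_def]; exact le_max_right _ _
      linarith⟩

lemma sliceCLM_apply (τ : ℝ) (K : 𝓢(ℝ × D, ℂ)) (x : D) : sliceCLM τ K x = K (τ, x) := rfl

/-- With the parameter treated as one more Schwartz variable, varying it is a translation in the
direction `(1, 0)`, and the result on translates applies to `v ∘ sliceCLM τ`. -/
lemma hasDerivAt_sliceCLM (v : 𝓢(D, ℂ) →L[ℂ] ℂ) (K : 𝓢(ℝ × D, ℂ)) (τ : ℝ) :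
    HasDerivAt (fun τ => v (sliceCLM τ K)) (v (sliceCLM τ (∂_{((1 : ℝ), (0 : D))} K))) τ := by
  have h1 := hasDerivAt_apply_translate (v.comp (sliceCLM τ)) K ((1 : ℝ), (0 : D))
  have h2 : (fun t : ℝ => (v.comp (sliceCLM τ))
      (SchwartzMap.compSubConstCLM ℝ (-(t • ((1 : ℝ), (0 : D)))) K)) =
      fun t => v (sliceCLM (τ + t) K) := by
    funext t
    rw [ContinuousLinearMap.comp_apply]
    congr 1
    ext x
    simp [sliceCLM_apply]
  rw [h2] at h1
  have h3 := HasDerivAt.comp_sub_const (f := fun t => v (sliceCLM (τ + t) K)) τ τ (by simpa using h1)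
  simpa using h3

end Analysis

/-! ### Extending squeezed functions off the mass shell -/

section Extension

variable {n : ℕ}

/-- The projection `(p^+, p_⊥, p^-) ↦ (p^+, p_⊥)`. -/
def spatial (n : ℕ) : Space (n + 1) →L[ℝ] Space n :=
  LinearMap.toContinuousLinearMap
    { toFun := fun p => WithLp.toLp 2 fun i => p i.castSucc
      map_add' := fun p q => by ext i; simp
      map_smul' := fun c p => by ext i; simp }

lemma spatial_apply (p : Space (n + 1)) (i : Fin n) : spatial n p i = p i.castSucc := rfl

variable [NeZero n]

lemma spatial_zero (p : Space (n + 1)) : spatial n p 0 = p 0 := by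
  rw [spatial_apply, Fin.castSucc_zero']

lemma spatial_shellPoint (m : ℝ) (p : Space n) : spatial n (shellPoint m p) = p := by
  ext i
  rw [spatial_apply, shellPoint_castSucc]

/-- The real-valued function `p̃² - m²`. -/
def massReal (m : ℝ) (p : Space (n + 1)) : ℝ := lcForm p p - m ^ 2

lemma massPoly_eq (m : ℝ) (p : Space (n + 1)) : massPoly m p = (massReal m p : ℂ) := rfl

lemma massReal_eq (m : ℝ) (p : Space (n + 1)) :
    massReal m p = 2 * p 0 * p (Fin.last n) - (perpSq (spatial n p) + m ^ 2) := by
  have h : ∑ i : Fin n with i ≠ 0, p i.castSucc * p i.castSucc = perpSq (spatial n p) :=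
    Finset.sum_congr rfl fun i _ => (sq _).symm
  rw [massReal, lcForm, h]
  ring

lemma massReal_shellPoint {m : ℝ} {p : Space n} (hp : p 0 ≠ 0) :
    massReal m (shellPoint m p) = 0 := by
  rw [massReal_eq, spatial_shellPoint, shellPoint_zero, shellPoint_last, lcEnergy]
  field_simp
  ring

lemma hasTemperateGrowth_massReal (m : ℝ) : (massReal (n := n) m).HasTemperateGrowth := by
  unfold massReal lcForm
  exact ((((hasTemperateGrowth_coord _).mul (hasTemperateGrowth_coord _)).add
    ((hasTemperateGrowth_coord _).mul (hasTemperateGrowth_coord _))).sub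
    (Function.HasTemperateGrowth.sum fun i _ =>
      (hasTemperateGrowth_coord _).mul (hasTemperateGrowth_coord _))).sub (.const _)

lemma norm_sq_eq_lightCone (p : Space (n + 1)) :
    ‖p‖ ^ 2 = p 0 ^ 2 + perpSq (spatial n p) + p (Fin.last n) ^ 2 := by
  rw [EuclideanSpace.norm_sq_eq, Fin.sum_univ_castSucc,
    ← Finset.add_sum_erase _ _ (Finset.mem_univ (0 : Fin n))]
  have he : (Finset.univ : Finset (Fin n)).erase 0 = Finset.univ.filter (· ≠ 0) := by
    ext i; simp
  rw [he, Fin.castSucc_zero']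
  simp only [Real.norm_eq_abs, sq_abs]
  rfl

lemma hasTemperateGrowth_bump (β : ContDiffBump (0 : ℝ)) :
    (fun t : ℝ => β t).HasTemperateGrowth :=
  β.hasCompactSupport.hasTemperateGrowth β.contDiff

/-- A cutoff function on the momentum line, equal to `1` at `0`. -/
def unitBump : ContDiffBump (0 : ℝ) := ⟨1, 2, one_pos, one_lt_two⟩

/-- The cutoff `χ(p̃² - m²)` to a neighbourhood of the mass shell. -/
def shellCutoff (m : ℝ) (p : Space (n + 1)) : ℂ := ((unitBump (massReal m p) : ℝ) : ℂ)

lemma hasTemperateGrowth_shellCutoff (m : ℝ) :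
    (shellCutoff (n := n) m).HasTemperateGrowth :=
  hasTemperateGrowth_ofReal
    ((hasTemperateGrowth_bump unitBump).comp (hasTemperateGrowth_massReal (n := n) m))

lemma abs_massReal_le_of_mem_tsupport {m : ℝ} {p : Space (n + 1)}
    (hp : p ∈ tsupport (shellCutoff (n := n) m)) : |massReal m p| ≤ 2 := by
  have hs : tsupport (shellCutoff (n := n) m) ⊆ {p | |massReal m p| ≤ 2} := by
    refine closure_minimal (fun y hy => ?_)
      (isClosed_le (hasTemperateGrowth_massReal (n := n) m).1.continuous.abs continuous_const)
    by_contra h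
    refine hy ?_
    have h1 : unitBump (massReal m y) = 0 := unitBump.zero_of_le_dist (by
      rw [dist_zero_right]; exact (not_le.1 h).le)
    simp [shellCutoff, h1]
  exact hs hp

/-- The seminorm with `k = -1` gives `‖D^i h‖ ≤ C |p^+|` off the hyperplane, and continuity carries
this to `p^+ = 0`, which the seminorms themselves do not see. -/
lemma iteratedFDeriv_eq_zero (h : SqueezedSchwartz n) (i : ℕ) {p : Space n} (hp : p 0 = 0) :
    iteratedFDeriv ℝ i h p = 0 := by
  obtain ⟨C, hC⟩ := h.2.2 (-1) 0 i
  have hc : Continuous (iteratedFDeriv ℝ i h) := h.contDiff.continuous_iteratedFDeriv (mod_cast le_top)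
  let γ : ℝ → Space n := fun t => p + t • EuclideanSpace.single 0 1
  have hγ : Continuous γ := by fun_prop
  have hγ0 : ∀ t, γ t 0 = t := fun t => by simp [γ, hp]
  have h1 : Filter.Tendsto (fun t => ‖iteratedFDeriv ℝ i h (γ t)‖) (nhdsWithin 0 (Set.Ioi 0))
      (nhds ‖iteratedFDeriv ℝ i h p‖) := by
    have := (hc.norm.comp hγ).tendsto 0
    simp only [Function.comp_apply, γ, zero_smul, add_zero] at this
    exact this.mono_left nhdsWithin_le_nhds
  have h2 : Filter.Tendsto (fun t : ℝ => C * t) (nhdsWithin 0 (Set.Ioi 0)) (nhds 0) := by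
    have : Filter.Tendsto (fun t : ℝ => C * t) (nhds 0) (nhds (C * 0)) :=
      (continuous_const.mul continuous_id).tendsto 0
    rw [mul_zero] at this
    exact this.mono_left nhdsWithin_le_nhds
  have h3 : ‖iteratedFDeriv ℝ i h p‖ ≤ 0 := by
    refine le_of_tendsto_of_tendsto h1 h2 ?_
    filter_upwards [self_mem_nhdsWithin] with t ht
    have ht' : 0 < t := ht
    have h4 := hC (γ t) (by rw [hγ0]; exact ht'.ne')
    change |γ t 0| ^ (-1 : ℤ) * √(perpSq (γ t)) ^ 0 * ‖iteratedFDeriv ℝ i h (γ t)‖ ≤ C at h4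
    rw [hγ0, abs_of_pos ht', zpow_neg_one, pow_zero, mul_one, inv_mul_le_iff₀ ht'] at h4
    linarith
  exact norm_eq_zero.1 (le_antisymm h3 (norm_nonneg _))

lemma squeezedWeight_le_seminorm (h : SqueezedSchwartz n) (k : ℤ) (l j : ℕ) {p : Space n}
    (hp : p 0 ≠ 0) : squeezedWeight k l j h p ≤ SqueezedSchwartz.seminorm n k l j h :=
  le_ciSup (h.bddAbove k l j) ⟨p, hp⟩

/-- Near the shell `p^-` is no independent variable: the bound on `massReal` forces it to be of
order `(1 + p_⊥²)/|p^+|`. This is where negative powers of `p^+` become necessary. -/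
lemma one_add_norm_le {m : ℝ} {p : Space (n + 1)} (hp : p 0 ≠ 0) (hP : |massReal m p| ≤ 2) :
    1 + ‖p‖ ≤ (3 + m ^ 2) * ((|p 0| + |p 0|⁻¹) * (1 + √(perpSq (spatial n p)) ^ 2)) := by
  set r := |p 0| with hr
  set s := √(perpSq (spatial n p)) with hs
  have hr0 : 0 < r := abs_pos.2 hp
  have hs0 : 0 ≤ s := Real.sqrt_nonneg _
  have hs2 : s ^ 2 = perpSq (spatial n p) := Real.sq_sqrt (perpSq_nonneg _)
  have hn : ‖p‖ ≤ r + s + |p (Fin.last n)| := by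
    refine abs_le_of_sq_le_sq' ?_ (by positivity) |>.2
    rw [norm_sq_eq_lightCone, ← hs2, ← sq_abs (p 0), ← sq_abs (p (Fin.last n)), ← hr]
    nlinarith [mul_nonneg hr0.le hs0, mul_nonneg hr0.le (abs_nonneg (p (Fin.last n))),
      mul_nonneg hs0 (abs_nonneg (p (Fin.last n)))]
  have hl : |p (Fin.last n)| ≤ (2 + s ^ 2 + m ^ 2) / 2 * r⁻¹ := by
    rw [massReal_eq, ← hs2] at hP
    have h1 : 2 * (r * |p (Fin.last n)|) ≤ 2 + s ^ 2 + m ^ 2 := by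
      have h2 : 2 * (r * |p (Fin.last n)|) = |2 * p 0 * p (Fin.last n)| := by
        rw [abs_mul, abs_mul, abs_two, hr]; ring
      rw [h2]
      have h3 := abs_le.1 hP
      rw [abs_le]
      constructor <;> nlinarith [sq_nonneg s, sq_nonneg m]
    rw [← div_eq_mul_inv, le_div_iff₀ hr0]
    linarith
  have hri : 0 < r⁻¹ := inv_pos.2 hr0
  have hrr : r * r⁻¹ = 1 := mul_inv_cancel₀ hr0.ne'
  -- This lets the product on the right absorb the terms `1` and `s`, which carry no power of `r`.
  have h2 : 2 ≤ r + r⁻¹ := by nlinarith [sq_nonneg (r - r⁻¹), sq_nonneg (r + r⁻¹ - 2)]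
  have hs1 : s ≤ (1 + s ^ 2) / 2 := by nlinarith [sq_nonneg (s - 1)]
  have hW : 2 * (1 + s ^ 2) ≤ (r + r⁻¹) * (1 + s ^ 2) :=
    mul_le_mul_of_nonneg_right h2 (by positivity)
  have e1 : r ≤ r * (1 + s ^ 2) := by nlinarith [mul_nonneg hr0.le (sq_nonneg s)]
  have e2 : (2 + s ^ 2 + m ^ 2) / 2 * r⁻¹ ≤ (1 + m ^ 2) * (r⁻¹ * (1 + s ^ 2)) := by
    have e3 : (2 + s ^ 2 + m ^ 2) / 2 ≤ (1 + m ^ 2) * (1 + s ^ 2) := by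
      nlinarith [sq_nonneg s, sq_nonneg m, mul_nonneg (sq_nonneg m) (sq_nonneg s)]
    calc _ ≤ (1 + m ^ 2) * (1 + s ^ 2) * r⁻¹ := mul_le_mul_of_nonneg_right e3 hri.le
      _ = _ := by ring
  have e4 : 0 ≤ m ^ 2 * (r * (1 + s ^ 2)) := by positivity
  nlinarith [sq_nonneg s]

lemma sum_pow_le_two_pow_mul (N : ℕ) {a b : ℝ} (ha : 0 ≤ a) (hb : 0 ≤ b) :
    (a + b) ^ N ≤ 2 ^ N * (a ^ N + b ^ N) := by
  refine (add_pow_le ha hb N).trans (mul_le_mul_of_nonneg_right ?_ (by positivity))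
  exact pow_le_pow_right₀ one_le_two (Nat.sub_le _ _)

/-- A sum of squeezed seminorms controlling the weight `(1 + ‖p‖)^N` near the mass shell. -/
def squeezedSum (N i : ℕ) (h : SqueezedSchwartz n) : ℝ :=
  SqueezedSchwartz.seminorm n N 0 i h + SqueezedSchwartz.seminorm n N (2 * N) i h +
    (SqueezedSchwartz.seminorm n (-N) 0 i h + SqueezedSchwartz.seminorm n (-N) (2 * N) i h)

lemma squeezedSum_nonneg (N i : ℕ) (h : SqueezedSchwartz n) : 0 ≤ squeezedSum N i h := by
  unfold squeezedSum; positivity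

lemma continuous_squeezedSum (N i : ℕ) : Continuous (squeezedSum (n := n) N i) := by
  have hc : ∀ (k : ℤ) (l j : ℕ), Continuous (SqueezedSchwartz.seminorm n k l j) := fun k l j =>
    (SqueezedSchwartz.withSeminorms n).continuous_seminorm (k, l, j)
  exact ((hc _ _ _).add (hc _ _ _)).add ((hc _ _ _).add (hc _ _ _))

lemma squeezedSum_zero (N i : ℕ) : squeezedSum (n := n) N i 0 = 0 := by
  simp [squeezedSum]

/-- Expanding the two sums in the bound `(r + r⁻¹) * (1 + s²)` after taking `N`-th powers leaves
exactly the four weights of `squeezedSum`. -/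
lemma weighted_le_squeezedSum {m : ℝ} (h : SqueezedSchwartz n) (N i : ℕ) {p : Space (n + 1)}
    (hP : |massReal m p| ≤ 2) :
    (1 + ‖p‖) ^ N * ‖iteratedFDeriv ℝ i h (spatial n p)‖ ≤
      ((3 + m ^ 2) * 4) ^ N * squeezedSum N i h := by
  by_cases hp : p 0 = 0
  · rw [iteratedFDeriv_eq_zero h i (by rwa [spatial_zero]), norm_zero, mul_zero]
    exact mul_nonneg (by positivity) (squeezedSum_nonneg N i h)
  · have h1 := one_add_norm_le hp hP
    set r := |p 0| with hr
    set s := √(perpSq (spatial n p)) with hs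
    set a := ‖iteratedFDeriv ℝ i h (spatial n p)‖ with ha
    have hr0 : 0 < r := abs_pos.2 hp
    have hs0 : 0 ≤ s := Real.sqrt_nonneg _
    have ha0 : 0 ≤ a := norm_nonneg _
    have hw : ∀ (k : ℤ) (l : ℕ), r ^ k * s ^ l * a ≤ SqueezedSchwartz.seminorm n k l i h :=
      fun k l => by
        have := squeezedWeight_le_seminorm h k l i (p := spatial n p) (by rwa [spatial_zero])
        rwa [squeezedWeight, spatial_zero] at this
    have h2 := hw N 0
    have h3 := hw N (2 * N)
    have h4 := hw (-N) 0
    have h5 := hw (-N) (2 * N)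
    have h6 : (r⁻¹) ^ N = r ^ (-N : ℤ) := by rw [zpow_neg, zpow_natCast, inv_pow]
    calc (1 + ‖p‖) ^ N * a
        ≤ ((3 + m ^ 2) * ((r + r⁻¹) * (1 + s ^ 2))) ^ N * a := by gcongr
      _ = (3 + m ^ 2) ^ N * ((r + r⁻¹) ^ N * (1 + s ^ 2) ^ N) * a := by rw [mul_pow, mul_pow]
      _ ≤ (3 + m ^ 2) ^ N * ((2 ^ N * (r ^ N + (r⁻¹) ^ N)) * (2 ^ N * (1 ^ N + (s ^ 2) ^ N))) * a := by
          gcongr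
          · exact sum_pow_le_two_pow_mul N hr0.le (by positivity)
          · exact sum_pow_le_two_pow_mul N one_pos.le (by positivity)
      _ = ((3 + m ^ 2) * 4) ^ N * (r ^ (N : ℤ) * s ^ 0 * a + r ^ (N : ℤ) * s ^ (2 * N) * a +
            (r ^ (-N : ℤ) * s ^ 0 * a + r ^ (-N : ℤ) * s ^ (2 * N) * a)) := by
          have h7 : (4 : ℝ) ^ N = 2 ^ N * 2 ^ N := by rw [← mul_pow]; norm_num
          rw [h6, mul_pow, h7, zpow_natCast, pow_mul]
          ring
      _ ≤ _ := by
          refine mul_le_mul_of_nonneg_left ?_ (by positivity)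
          unfold squeezedSum
          linarith

/-- The single bound `Q` serves twice: its finiteness makes the extension a Schwartz function, and
its continuity with `Q 0 = 0` makes the extension map continuous. -/
lemma exists_decay_shellExtend (m : ℝ) (k j : ℕ) :
    ∃ Q : SqueezedSchwartz n → ℝ, Continuous Q ∧ Q 0 = 0 ∧ (∀ h, 0 ≤ Q h) ∧ ∀ h p,
      ‖p‖ ^ k * ‖iteratedFDeriv ℝ j (fun p => h (spatial n p) * shellCutoff m p) p‖ ≤ Q h := by
  obtain ⟨N, C, hC, hb⟩ := exists_decay_mul (hasTemperateGrowth_shellCutoff (n := n) m) k j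
  let M : SqueezedSchwartz n → ℝ := fun h => ∑ i ∈ Finset.range (j + 1),
    ‖spatial n‖ ^ i * (((3 + m ^ 2) * 4) ^ N * squeezedSum N i h)
  have hM0 : ∀ (h : SqueezedSchwartz n) (i : ℕ), 0 ≤ ‖spatial n‖ ^ i * (((3 + m ^ 2) * 4) ^ N * squeezedSum N i h) :=
    fun h i => mul_nonneg (by positivity) (mul_nonneg (by positivity) (squeezedSum_nonneg N i h))
  have hM : ∀ h : SqueezedSchwartz n, 0 ≤ M h := fun h => Finset.sum_nonneg fun i _ => hM0 h i
  refine ⟨fun h => C * M h, ?_, ?_, fun h => mul_nonneg hC (hM h), fun h => ?_⟩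
  · exact continuous_const.mul (continuous_finsetSum _ fun i _ =>
      continuous_const.mul (continuous_const.mul (continuous_squeezedSum (n := n) N i)))
  · simp [M, squeezedSum_zero]
  · refine hb (fun p => h (spatial n p)) (h.contDiff.comp (spatial n).contDiff) (M h) (hM h)
      fun p hp i hi => le_trans ?_ (Finset.single_le_sum (fun i _ => hM0 h i)
        (Finset.mem_range.2 (Nat.lt_succ_of_le hi)))
    have h1 := norm_iteratedFDeriv_comp_clm_le h.contDiff (spatial n) i p
    have h2 := weighted_le_squeezedSum h N i (abs_massReal_le_of_mem_tsupport hp)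
    calc (1 + ‖p‖) ^ N * ‖iteratedFDeriv ℝ i (fun p => h (spatial n p)) p‖
        ≤ (1 + ‖p‖) ^ N * (‖spatial n‖ ^ i * ‖iteratedFDeriv ℝ i h (spatial n p)‖) := by gcongr
      _ = ‖spatial n‖ ^ i * ((1 + ‖p‖) ^ N * ‖iteratedFDeriv ℝ i h (spatial n p)‖) := by ring
      _ ≤ _ := mul_le_mul_of_nonneg_left h2 (by positivity)

/-- The extension `p ↦ h(p^+, p_⊥) χ(p̃² - m²)` of a squeezed Schwartz function, as a linear map. -/
def shellExtendLM (m : ℝ) : SqueezedSchwartz n →ₗ[ℂ] 𝓢(Space (n + 1), ℂ) where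
  toFun h :=
    { toFun := fun p => h (spatial n p) * shellCutoff m p
      smooth' := (h.contDiff.comp (spatial n).contDiff).mul (hasTemperateGrowth_shellCutoff (n := n) m).1
      decay' := fun k j => by
        obtain ⟨Q, -, -, -, hQ⟩ := exists_decay_shellExtend (n := n) m k j
        exact ⟨Q h, hQ h⟩ }
  map_add' f g := by
    ext p
    exact add_mul (f (spatial n p)) (g (spatial n p)) _
  map_smul' c f := by
    ext p
    exact mul_assoc c (f (spatial n p)) _

/-- `shellExtendLM` as a continuous linear map. -/
def shellExtend (m : ℝ) : SqueezedSchwartz n →L[ℂ] 𝓢(Space (n + 1), ℂ) where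
  toLinearMap := shellExtendLM m
  cont := by
    refine (schwartz_withSeminorms ℂ (Space (n + 1)) ℂ).continuous_of_continuous_comp
      (shellExtendLM m) ?_
    rintro ⟨k, j⟩
    obtain ⟨Q, hQc, hQ0, hQn, hQ⟩ := exists_decay_shellExtend (n := n) m k j
    refine Seminorm.continuous_of_continuousAt_zero ?_
    rw [ContinuousAt, map_zero]
    have h0 : Filter.Tendsto Q (nhds 0) (nhds 0) := by
      simpa only [hQ0] using hQc.tendsto 0
    exact squeeze_zero (fun f => apply_nonneg _ f)
      (fun f => SchwartzMap.seminorm_le_bound ℂ k j _ (hQn f) (hQ f)) h0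

lemma shellExtend_apply (m : ℝ) (h : SqueezedSchwartz n) (p : Space (n + 1)) :
    shellExtend m h p = h (spatial n p) * shellCutoff m p := rfl

lemma shellExtend_shellPoint (m : ℝ) (h : SqueezedSchwartz n) {p : Space n} (hp : p 0 ≠ 0) :
    shellExtend m h (shellPoint m p) = h p := by
  rw [shellExtend_apply, spatial_shellPoint, shellCutoff, massReal_shellPoint hp,
    unitBump.one_of_mem_closedBall (by simpa using unitBump.rIn_pos.le)]
  simp

/-- The extension of `2 p^+ h` to a Schwartz function. -/
def plusExtend (m : ℝ) : SqueezedSchwartz n →L[ℂ] 𝓢(Space (n + 1), ℂ) :=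
  -- The factor is `2 p^+` and not `2 |p^+|`, because it has to be smooth across `p^+ = 0`; the
  -- missing sign is supplied by `signMul`.
  (SchwartzMap.smulLeftCLM ℂ fun p : Space (n + 1) => ((2 * p 0 : ℝ) : ℂ)).comp (shellExtend m)

lemma plusExtend_shellPoint (m : ℝ) (h : SqueezedSchwartz n) {p : Space n} (hp : p 0 ≠ 0) :
    plusExtend m h (shellPoint m p) = ((2 * p 0 : ℝ) : ℂ) * h p := by
  have ht : (fun p : Space (n + 1) => ((2 * p 0 : ℝ) : ℂ)).HasTemperateGrowth :=
    hasTemperateGrowth_ofReal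
      ((Function.HasTemperateGrowth.const (2 : ℝ)).mul (hasTemperateGrowth_coord (k := n + 1) 0))
  rw [plusExtend, ContinuousLinearMap.comp_apply, SchwartzMap.smulLeftCLM_apply_apply ht,
    shellExtend_shellPoint m h hp, shellPoint_zero, smul_eq_mul]

lemma SqueezedSchwartz.ext {f g : SqueezedSchwartz n} (h : ∀ p, f p = g p) : f = g :=
  Subtype.ext (funext h)

lemma squeezed_apply_eq_zero (h : SqueezedSchwartz n) {p : Space n} (hp : p 0 = 0) : h p = 0 := by
  have := iteratedFDeriv_eq_zero h 0 hp
  rwa [← norm_eq_zero, norm_iteratedFDeriv_zero, norm_eq_zero] at this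

/-- Multiplication of squeezed Schwartz functions by a function of the sign of `p^+`. -/
def signMul {m : ℝ} (hm : m ≠ 0) (η : SignType → ℝ) : SqueezedSchwartz n →L[ℂ] SqueezedSchwartz n :=
  -- Restricting the extension of `2 p^+ h` and dividing by `2 |p^+|` gives `sign(p^+) h`; the extra
  -- factor `s` cancels this sign. Smoothness and continuity come for free from the two maps
  -- composed.
  (onShellCLM hm fun s => η s * (s : ℝ)).comp (plusExtend m)

lemma signMul_apply {m : ℝ} (hm : m ≠ 0) (η : SignType → ℝ) (h : SqueezedSchwartz n)
    (p : Space n) : signMul hm η h p = (η (SignType.sign (p 0)) : ℂ) * h p := by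
  rw [signMul, ContinuousLinearMap.comp_apply, onShellCLM_apply, onShell]
  by_cases hp : p 0 = 0
  · rw [if_pos hp, squeezed_apply_eq_zero h hp, mul_zero]
  · rw [if_neg hp, plusExtend_shellPoint m h hp, ← mul_assoc, ← Complex.ofReal_mul]
    congr 2
    rcases lt_or_gt_of_ne hp with h | h
    · rw [abs_of_neg h, sign_neg h]; simp; field_simp
    · rw [abs_of_pos h, sign_pos h]; simp; field_simp

/-- A continuous right inverse of the restriction to the mass shell. -/
def onShellSection {m : ℝ} (hm : m ≠ 0) : SqueezedSchwartz n →L[ℂ] 𝓢(Space (n + 1), ℂ) :=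
  (plusExtend m).comp (signMul hm fun s => (s : ℝ))

lemma onShellCLM_onShellSection {m : ℝ} (hm : m ≠ 0) (h : SqueezedSchwartz n) :
    onShellCLM hm (fun _ => 1) (onShellSection hm h) = h := by
  refine SqueezedSchwartz.ext fun p => ?_
  rw [onShellCLM_apply, onShell]
  by_cases hp : p 0 = 0
  · rw [if_pos hp, squeezed_apply_eq_zero h hp]
  · rw [if_neg hp, onShellSection, ContinuousLinearMap.comp_apply, plusExtend_shellPoint m _ hp,
      signMul_apply, ← mul_assoc, ← mul_assoc, ← Complex.ofReal_mul, ← Complex.ofReal_mul]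
    convert one_mul (h p) using 2
    rw [← Complex.ofReal_one]
    congr 1
    rcases lt_or_gt_of_ne hp with h | h
    · rw [abs_of_neg h, sign_neg h]; simp; field_simp
    · rw [abs_of_pos h, sign_pos h]; simp; field_simp

end Extension

/-! ### Solutions of the division problem vanish on functions that are zero on the shell -/

section Division

variable {n : ℕ} [NeZero n]

/-- A cutoff on the momentum line at the scale `m²`, equal to `1` on `[-m²/14, m²/14]` and supported
in `[-m²/7, m²/7]`. -/
def massBump {m : ℝ} (hm : m ≠ 0) : ContDiffBump (0 : ℝ) :=
  -- The outer radius is chosen so that the relative shift of `p^-` is at most `(m²/7) / (6m²/7) =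
  -- 1/6`; with times bounded by `3` this is at most `1/2`, which keeps the deformation proper.
  ⟨m ^ 2 / 14, m ^ 2 / 7, by positivity, by
    have : 0 < m ^ 2 := by positivity
    linarith⟩

lemma abs_mul_massBump_le {m : ℝ} (hm : m ≠ 0) (t : ℝ) : |t * massBump hm t| ≤ m ^ 2 / 7 := by
  by_cases ht : |t| ≤ m ^ 2 / 7
  · rw [abs_mul, abs_of_nonneg (massBump hm).nonneg]
    exact (mul_le_of_le_one_right (abs_nonneg t) (massBump hm).le_one).trans ht
  · rw [(massBump hm).zero_of_le_dist (by
      rw [Real.dist_0_eq_abs]; exact (not_le.1 ht).le), mul_zero, abs_zero]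
    positivity

/-- A positive function of temperate growth that equals `2 p^+ p^-` near the mass shell. -/
def flowDenom {m : ℝ} (hm : m ≠ 0) (p : Space (n + 1)) : ℝ :=
  massReal m p * massBump hm (massReal m p) + (perpSq (spatial n p) + m ^ 2)

lemma le_flowDenom {m : ℝ} (hm : m ≠ 0) (p : Space (n + 1)) :
    6 / 7 * m ^ 2 ≤ flowDenom hm p := by
  have h1 := (abs_le.1 (abs_mul_massBump_le hm (massReal m p))).1
  have h2 := perpSq_nonneg (spatial n p)
  unfold flowDenom
  linarith

lemma flowDenom_pos {m : ℝ} (hm : m ≠ 0) (p : Space (n + 1)) : 0 < flowDenom hm p :=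
  lt_of_lt_of_le (by positivity) (le_flowDenom hm p)

lemma hasTemperateGrowth_perpSq_spatial :
    (fun p : Space (n + 1) => perpSq (spatial n p)).HasTemperateGrowth := by
  unfold perpSq
  exact Function.HasTemperateGrowth.sum fun i _ => (hasTemperateGrowth_coord _).pow 2

lemma hasTemperateGrowth_massBump {m : ℝ} (hm : m ≠ 0) :
    (fun p : Space (n + 1) => massBump hm (massReal m p)).HasTemperateGrowth :=
  (hasTemperateGrowth_bump (massBump hm)).comp (hasTemperateGrowth_massReal m)

lemma hasTemperateGrowth_flowDenom {m : ℝ} (hm : m ≠ 0) :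
    (flowDenom (n := n) hm).HasTemperateGrowth :=
  ((hasTemperateGrowth_massReal m).mul (hasTemperateGrowth_massBump hm)).add
    (hasTemperateGrowth_perpSq_spatial.add (.const _))

/-- A function of temperate growth that equals `1 / (2 p^+)` near the mass shell. -/
def flowCoeff {m : ℝ} (hm : m ≠ 0) (p : Space (n + 1)) : ℝ :=
  massBump hm (massReal m p) * (p (Fin.last n) * (flowDenom hm p)⁻¹)

lemma hasTemperateGrowth_flowCoeff {m : ℝ} (hm : m ≠ 0) :
    (flowCoeff (n := n) hm).HasTemperateGrowth :=
  (hasTemperateGrowth_massBump hm).mul ((hasTemperateGrowth_coord _).mul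
    (hasTemperateGrowth_inv (hasTemperateGrowth_flowDenom hm) (by positivity) (le_flowDenom hm)))

/-- The displacement is a small multiple of `p^-` itself, so the deformation rescales `p^-` by a
factor close to `1`. -/
lemma abs_massReal_mul_flowCoeff_le {m : ℝ} (hm : m ≠ 0) (p : Space (n + 1)) :
    ∃ c : ℝ, |c| ≤ 1 / 6 ∧ massReal m p * flowCoeff hm p = c * p (Fin.last n) := by
  refine ⟨massReal m p * massBump hm (massReal m p) * (flowDenom hm p)⁻¹, ?_, ?_⟩
  · have h0 := flowDenom_pos hm p
    rw [abs_mul, abs_inv, abs_of_pos h0, ← div_eq_mul_inv, div_le_iff₀ h0]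
    have h1 := abs_mul_massBump_le hm (massReal m p)
    have h2 := le_flowDenom hm p
    linarith
  · unfold flowCoeff
    ring

/-- The unit vector in the `p^-`-direction. -/
def minusVec (n : ℕ) : Space (n + 1) := EuclideanSpace.single (Fin.last n) 1

/-- A deformation of momentum space along `p^-`, which at time `1` maps a neighbourhood of the mass
shell to the mass shell. -/
def shellFlow {m : ℝ} (hm : m ≠ 0) (σ : ℝ) (p : Space (n + 1)) : Space (n + 1) :=
  p + σ • (-(massReal m p * flowCoeff hm p) • minusVec n)

/-- Here the cutoff is `1` and `flowDenom` is `2 p^+ p^-`; its positivity gives `p^+ ≠ 0`. Since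
`massReal` is affine in `p^-` with slope `2 p^+`, a single Newton step lands exactly on the shell.
-/
lemma shellFlow_one {m : ℝ} (hm : m ≠ 0) {p : Space (n + 1)} (hp : |massReal m p| ≤ m ^ 2 / 14) :
    p 0 ≠ 0 ∧ shellFlow hm 1 p = shellPoint m (spatial n p) := by
  have hb : massBump hm (massReal m p) = 1 := (massBump hm).one_of_mem_closedBall (by
    rw [mem_closedBall_zero_iff, Real.norm_eq_abs]; exact hp)
  have hN : flowDenom hm p = 2 * p 0 * p (Fin.last n) := by
    rw [flowDenom, hb, massReal_eq]; ring
  have hpos := flowDenom_pos hm p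
  have h0 : p 0 ≠ 0 := by
    rintro h
    rw [hN, h] at hpos
    simp at hpos
  have hl : p (Fin.last n) ≠ 0 := by
    rintro h
    rw [hN, h] at hpos
    simp at hpos
  refine ⟨h0, ?_⟩
  ext i
  refine Fin.lastCases ?_ (fun i => ?_) i
  · rw [shellPoint_last, lcEnergy, spatial_zero]
    simp only [shellFlow, minusVec, flowCoeff, hb, hN, PiLp.add_apply, PiLp.smul_apply,
      PiLp.single_apply, if_true, smul_eq_mul]
    rw [massReal_eq]
    field_simp
    ring
  · rw [shellPoint_castSucc, spatial_apply]
    simp [shellFlow, minusVec, (Fin.castSucc_lt_last i).ne]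

/-- A cutoff in time, equal to `1` on `[-2, 2]`. -/
def timeBump : ContDiffBump (0 : ℝ) := ⟨2, 3, by norm_num, by norm_num⟩

lemma timeBump_eq_one {τ : ℝ} (hτ : |τ| ≤ 2) : timeBump τ = 1 :=
  timeBump.one_of_mem_closedBall (by rw [mem_closedBall_zero_iff, Real.norm_eq_abs]; exact hτ)

/-- A bounded time parameter, equal to `τ` on `[-2, 2]`. -/
def timeCut (τ : ℝ) : ℝ := τ * timeBump τ

lemma timeCut_eq {τ : ℝ} (hτ : |τ| ≤ 2) : timeCut τ = τ := by
  rw [timeCut, timeBump_eq_one hτ, mul_one]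

lemma abs_timeCut_le (τ : ℝ) : |timeCut τ| ≤ 3 := by
  by_cases hτ : |τ| ≤ 3
  · rw [timeCut, abs_mul, abs_of_nonneg timeBump.nonneg]
    exact (mul_le_of_le_one_right (abs_nonneg τ) timeBump.le_one).trans hτ
  · rw [timeCut, timeBump.zero_of_le_dist (by
      rw [Real.dist_0_eq_abs]; exact (not_le.1 hτ).le), mul_zero, abs_zero]
    norm_num

lemma hasTemperateGrowth_timeCut : timeCut.HasTemperateGrowth :=
  Function.HasTemperateGrowth.id'.mul (hasTemperateGrowth_bump timeBump)

/-- The flow with bounded time, as a map of `ℝ × ℝ^{1+n}`. -/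
def spaceTimeFlow {m : ℝ} (hm : m ≠ 0) (x : ℝ × Space (n + 1)) : ℝ × Space (n + 1) :=
  (x.1, shellFlow hm (timeCut x.1) x.2)

lemma spaceTimeFlow_eq {m : ℝ} (hm : m ≠ 0) (x : ℝ × Space (n + 1)) :
    spaceTimeFlow hm x =
      x - (timeCut x.1 * (massReal m x.2 * flowCoeff hm x.2)) • ((0 : ℝ), minusVec n) := by
  refine Prod.ext ?_ ?_
  · simp [spaceTimeFlow]
  · simp [spaceTimeFlow, shellFlow, smul_smul, sub_eq_add_neg]

lemma hasTemperateGrowth_spaceTimeFlow {m : ℝ} (hm : m ≠ 0) :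
    (spaceTimeFlow (n := n) hm).HasTemperateGrowth := by
  have h : spaceTimeFlow (n := n) hm = fun x =>
      x - (timeCut x.1 * (massReal m x.2 * flowCoeff hm x.2)) • ((0 : ℝ), minusVec n) :=
    funext (spaceTimeFlow_eq hm)
  have h1 : (fun x : ℝ × Space (n + 1) => timeCut x.1).HasTemperateGrowth :=
    hasTemperateGrowth_timeCut.comp (ContinuousLinearMap.fst ℝ ℝ (Space (n + 1))).hasTemperateGrowth
  have h2 : (fun x : ℝ × Space (n + 1) => massReal m x.2 * flowCoeff hm x.2).HasTemperateGrowth :=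
    ((hasTemperateGrowth_massReal m).mul (hasTemperateGrowth_flowCoeff hm)).comp
      (ContinuousLinearMap.snd ℝ ℝ (Space (n + 1))).hasTemperateGrowth
  rw [h]
  exact Function.HasTemperateGrowth.id'.sub ((h1.mul h2).smul (.const _))

/-- This properness is what composition with the flow needs to preserve Schwartz functions. The flow
multiplies `p^-` by `1 - d` with `|d| ≤ 1/2`, so the displacement `|d p^-|` is at most the size of
the new `p^-`. -/
lemma norm_le_spaceTimeFlow {m : ℝ} (hm : m ≠ 0) (x : ℝ × Space (n + 1)) :
    ‖x‖ ≤ 2 * (1 + ‖spaceTimeFlow hm x‖) ^ 1 := by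
  obtain ⟨c, hc, hw⟩ := abs_massReal_mul_flowCoeff_le hm x.2
  have h0 := spaceTimeFlow_eq hm x
  set s := timeCut x.1 * (massReal m x.2 * flowCoeff hm x.2) with hs
  set q := spaceTimeFlow hm x with hq
  have hd : |timeCut x.1 * c| ≤ 1 / 2 := by
    rw [abs_mul]
    calc |timeCut x.1| * |c| ≤ 3 * (1 / 6) :=
          mul_le_mul (abs_timeCut_le _) hc (abs_nonneg _) (by norm_num)
      _ = 1 / 2 := by norm_num
  have hs' : s = timeCut x.1 * c * x.2 (Fin.last n) := by rw [hs, hw, mul_assoc]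
  have hl : q.2 (Fin.last n) = x.2 (Fin.last n) * (1 - timeCut x.1 * c) := by
    rw [h0]
    simp [minusVec, hs']
    ring
  have h1 : |s| ≤ |q.2 (Fin.last n)| := by
    rw [hl, hs', abs_mul, abs_mul (x.2 (Fin.last n)), mul_comm]
    refine mul_le_mul_of_nonneg_left (hd.trans ?_) (abs_nonneg _)
    have := (abs_le.1 hd).2
    exact le_trans (by linarith) (le_abs_self _)
  have h2 : |q.2 (Fin.last n)| ≤ ‖q‖ :=
    (PiLp.norm_apply_le q.2 (Fin.last n)).trans (by rw [Prod.norm_def]; exact le_max_right _ _)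
  have h3 : ‖((0 : ℝ), minusVec n)‖ = 1 := by
    rw [Prod.norm_def]
    simp [minusVec]
  have h4 : x = q + s • ((0 : ℝ), minusVec n) := by rw [h0, sub_add_cancel]
  have h5 : ‖x‖ ≤ ‖q‖ + |s| := by
    calc ‖x‖ = ‖q + s • ((0 : ℝ), minusVec n)‖ := by rw [← h4]
      _ ≤ ‖q‖ + ‖s • ((0 : ℝ), minusVec n)‖ := norm_add_le _ _
      _ = ‖q‖ + |s| := by rw [norm_smul, h3, mul_one, Real.norm_eq_abs]
  rw [pow_one]
  linarith

/-- The Schwartz function `(τ, p) ↦ f(Φ_τ(p))`, cut off in time. -/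
def flowed {m : ℝ} (hm : m ≠ 0) (f : 𝓢(Space (n + 1), ℂ)) : 𝓢(ℝ × Space (n + 1), ℂ) :=
  SchwartzMap.compCLM ℂ (hasTemperateGrowth_spaceTimeFlow hm) ⟨1, 2, norm_le_spaceTimeFlow hm⟩
    (cutoffTensor timeBump f)

lemma flowed_apply {m : ℝ} (hm : m ≠ 0) (f : 𝓢(Space (n + 1), ℂ)) {τ : ℝ} (hτ : |τ| ≤ 2)
    (p : Space (n + 1)) : flowed hm f (τ, p) = f (shellFlow hm τ p) := by
  rw [flowed, SchwartzMap.compCLM_apply, Function.comp_apply, cutoffTensor_apply, spaceTimeFlow,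
    timeBump_eq_one hτ, timeCut_eq hτ]
  simp

/-- For `|τ| < 2` both time cutoffs are inactive and the path is affine in `τ`; its velocity
contains the factor `massReal`, which the chain rule brings out. -/
lemma lineDerivOp_flowed_apply {m : ℝ} (hm : m ≠ 0) (f : 𝓢(Space (n + 1), ℂ)) {τ : ℝ}
    (hτ : |τ| < 2) (p : Space (n + 1)) :
    ∂_{((1 : ℝ), (0 : Space (n + 1)))} (flowed hm f) (τ, p) =
      massPoly m p * ((-flowCoeff hm p : ℝ) * flowed hm (∂_{minusVec n} f) (τ, p)) := by
  have h1 := hasDerivAt_translate f (-(massReal m p * flowCoeff hm p) • minusVec n) p (τ + 0)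
  have h2 := HasDerivAt.comp_const_add τ 0 h1
  have h3 : (fun t : ℝ => flowed hm f ((τ, p) + t • ((1 : ℝ), (0 : Space (n + 1))))) =ᶠ[nhds 0]
      fun t => f (p + (τ + t) • (-(massReal m p * flowCoeff hm p) • minusVec n)) := by
    have hc : ∀ᶠ t : ℝ in nhds 0, |τ + t| < 2 := by
      have : Continuous fun t : ℝ => |τ + t| := by fun_prop
      exact this.continuousAt.eventually_lt_const (by simpa using hτ)
    filter_upwards [hc] with t ht
    have h4 : (τ, p) + t • ((1 : ℝ), (0 : Space (n + 1))) = (τ + t, p) := by simp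
    rw [h4, flowed_apply hm f ht.le, shellFlow]
  rw [SchwartzMap.lineDerivOp_apply, lineDeriv, h3.deriv_eq, h2.deriv, add_zero,
    SchwartzMap.lineDerivOp_apply_eq_fderiv, map_smul, flowed_apply hm _ hτ.le, massPoly_eq,
    SchwartzMap.lineDerivOp_apply_eq_fderiv, shellFlow, Complex.real_smul]
  push_cast
  ring

/-- A cutoff on the momentum line supported in `[-m²/14, m²/14]`. -/
def innerBump {m : ℝ} (hm : m ≠ 0) : ContDiffBump (0 : ℝ) :=
  ⟨m ^ 2 / 28, m ^ 2 / 14, by positivity, by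
    have : 0 < m ^ 2 := by positivity
    linarith⟩

lemma le_sq_add_innerBump {m : ℝ} (hm : m ≠ 0) (t : ℝ) :
    min 1 ((m ^ 2 / 28) ^ 2) ≤ t ^ 2 + innerBump hm t := by
  by_cases ht : |t| ≤ m ^ 2 / 28
  · rw [(innerBump hm).one_of_mem_closedBall (by
      rw [mem_closedBall_zero_iff, Real.norm_eq_abs]; exact ht)]
    exact (min_le_left _ _).trans (by linarith [sq_nonneg t])
  · refine (min_le_right _ _).trans ?_
    have h1 : (m ^ 2 / 28) ^ 2 ≤ |t| ^ 2 := by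
      have := (not_le.1 ht).le
      gcongr
    rw [sq_abs] at h1
    linarith [(innerBump hm).nonneg (x := t)]

/-- Division away from the shell: `P⁻¹` is replaced by `P / (P² + χ(P))`, whose denominator is
bounded below everywhere. The bump `χ` is zero wherever `f` can be nonzero, so multiplying back by
`P` recovers `f`. -/
lemma apply_eq_zero_of_vanish_near_shell {m : ℝ} (hm : m ≠ 0) (v : 𝓢(Space (n + 1), ℂ) →L[ℂ] ℂ)
    (hv : ∀ g, v (SchwartzMap.smulLeftCLM ℂ (massPoly m) g) = 0) (f : 𝓢(Space (n + 1), ℂ))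
    (hf : ∀ p, |massReal m p| ≤ m ^ 2 / 14 → f p = 0) : v f = 0 := by
  let d : Space (n + 1) → ℝ := fun p => massReal m p ^ 2 + innerBump hm (massReal m p)
  have hd : ∀ p, min 1 ((m ^ 2 / 28) ^ 2) ≤ d p := fun p => le_sq_add_innerBump hm _
  have hc : 0 < min 1 ((m ^ 2 / 28) ^ 2) := lt_min one_pos (by positivity)
  have hdt : d.HasTemperateGrowth := ((hasTemperateGrowth_massReal m).pow 2).add
    ((hasTemperateGrowth_bump (innerBump hm)).comp (hasTemperateGrowth_massReal m))
  have ht : (fun p : Space (n + 1) => ((massReal m p * (d p)⁻¹ : ℝ) : ℂ)).HasTemperateGrowth :=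
    hasTemperateGrowth_ofReal
      ((hasTemperateGrowth_massReal m).mul (hasTemperateGrowth_inv hdt hc hd))
  have h1 : SchwartzMap.smulLeftCLM ℂ (massPoly m) (SchwartzMap.smulLeftCLM ℂ
      (fun p : Space (n + 1) => ((massReal m p * (d p)⁻¹ : ℝ) : ℂ)) f) = f := by
    ext p
    rw [SchwartzMap.smulLeftCLM_apply_apply (hasTemperateGrowth_massPoly m),
      SchwartzMap.smulLeftCLM_apply_apply ht, smul_smul, smul_eq_mul]
    by_cases hp : |massReal m p| ≤ m ^ 2 / 14
    · rw [hf p hp, mul_zero]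
    · have hd0 : d p = massReal m p ^ 2 := by
        simp only [d]
        rw [(innerBump hm).zero_of_le_dist (by
          rw [Real.dist_0_eq_abs]; exact (not_le.1 hp).le), add_zero]
      have hp0 : massReal m p ≠ 0 := by
        rintro h
        rw [h, abs_zero] at hp
        exact hp (by positivity)
      have h2 : massPoly m p * ((massReal m p * (d p)⁻¹ : ℝ) : ℂ) = 1 := by
        rw [massPoly_eq, ← Complex.ofReal_mul, hd0, ← Complex.ofReal_one]
        congr 1
        field_simp
      rw [h2, one_mul]
  rw [← h1]
  exact hv _

/-- A tempered distribution annihilated by `p̃² - m²` vanishes on all Schwartz functions that vanish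
on the mass shell. -/
lemma apply_eq_zero_of_vanish_on_shell {m : ℝ} (hm : m ≠ 0) (v : 𝓢(Space (n + 1), ℂ) →L[ℂ] ℂ)
    (hv : ∀ g, v (SchwartzMap.smulLeftCLM ℂ (massPoly m) g) = 0) (f : 𝓢(Space (n + 1), ℂ))
    (hf : ∀ p : Space n, p 0 ≠ 0 → f (shellPoint m p) = 0) : v f = 0 := by
  -- The velocity of the deformed function is `massPoly` times a Schwartz function, which `v`
  -- annihilates.
  have hderiv : ∀ τ : ℝ, |τ| < 2 → HasDerivAt (fun τ => v (sliceCLM τ (flowed hm f))) 0 τ := by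
    intro τ hτ
    have h1 := hasDerivAt_sliceCLM v (flowed hm f) τ
    have ht : (fun p : Space (n + 1) => ((-flowCoeff hm p : ℝ) : ℂ)).HasTemperateGrowth :=
      hasTemperateGrowth_ofReal (hasTemperateGrowth_flowCoeff hm).neg
    have h2 : sliceCLM τ (∂_{((1 : ℝ), (0 : Space (n + 1)))} (flowed hm f)) =
        SchwartzMap.smulLeftCLM ℂ (massPoly m) (SchwartzMap.smulLeftCLM ℂ
          (fun p : Space (n + 1) => ((-flowCoeff hm p : ℝ) : ℂ))
          (sliceCLM τ (flowed hm (∂_{minusVec n} f)))) := by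
      ext p
      rw [SchwartzMap.smulLeftCLM_apply_apply (hasTemperateGrowth_massPoly m),
        SchwartzMap.smulLeftCLM_apply_apply ht, sliceCLM_apply, sliceCLM_apply,
        lineDerivOp_flowed_apply hm f hτ, smul_eq_mul, smul_eq_mul]
    rw [h2, hv] at h1
    exact h1
  have hconst := constant_of_has_deriv_right_zero (a := 0) (b := 1)
    (f := fun τ => v (sliceCLM τ (flowed hm f)))
    (fun τ hτ => (hderiv τ (by rw [abs_of_nonneg hτ.1]; linarith [hτ.2])).continuousAt.continuousWithinAt)
    (fun τ hτ => (hderiv τ (by rw [abs_of_nonneg hτ.1]; linarith [hτ.2])).hasDerivWithinAt)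
    1 (by simp)
  have h0 : sliceCLM 0 (flowed hm f) = f := by
    ext p
    rw [sliceCLM_apply, flowed_apply hm f (by simp), shellFlow, zero_smul, add_zero]
  -- At time `1` a whole neighbourhood of the shell is mapped into the shell, where `f` is zero.
  have h1 : v (sliceCLM 1 (flowed hm f)) = 0 := by
    refine apply_eq_zero_of_vanish_near_shell hm v hv _ fun p hp => ?_
    obtain ⟨hp0, hp1⟩ := shellFlow_one hm hp
    rw [sliceCLM_apply, flowed_apply hm f (by norm_num), hp1]
    exact hf _ (by rwa [spatial_zero])
  simp only [h0, h1] at hconst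
  exact hconst.symm

end Division

/-! ### The light-cone Fourier transform of the Klein-Gordon equation -/

section Fourier

variable {n : ℕ} [NeZero n]

lemma hasTemperateGrowth_lcForm (e : Space (n + 1)) :
    (fun p : Space (n + 1) => lcForm p e).HasTemperateGrowth := by
  unfold lcForm
  exact (((hasTemperateGrowth_coord _).mul (.const _)).add
    ((hasTemperateGrowth_coord _).mul (.const _))).sub
    (Function.HasTemperateGrowth.sum fun i _ => (hasTemperateGrowth_coord _).mul (.const _))

lemma hasTemperateGrowth_I_mul_lcForm (e : Space (n + 1)) :
    (fun p : Space (n + 1) => Complex.I * (lcForm p e : ℂ)).HasTemperateGrowth :=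
  (Function.HasTemperateGrowth.const _).mul (hasTemperateGrowth_ofReal (hasTemperateGrowth_lcForm e))

lemma inner_lcScale (p e : Space (n + 1)) :
    inner ℝ p (lcScale n e) = -(2 * Real.pi)⁻¹ * lcForm p e := by
  have h : lcScale n e = lcDual n ((-(2 * Real.pi)⁻¹) • e) := rfl
  rw [h, map_smul, inner_smul_right, inner_lcDual]

/-- The factor `-2πi` from the standard Fourier kernel meets `-(2π)⁻¹` from `lcScale`, leaving `i`.
-/
lemma lineDerivOp_lcFourier (f : 𝓢(Space (n + 1), ℂ)) (e : Space (n + 1)) :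
    ∂_{e} (lcFourier n f) =
      lcFourier n (SchwartzMap.smulLeftCLM ℂ (fun p => Complex.I * (lcForm p e : ℂ)) f) := by
  have h1 : ∀ g, lcFourier n g =
      SchwartzMap.compCLMOfContinuousLinearEquiv ℂ (lcScale n) (𝓕 g) := fun g => rfl
  have hi : (fun p : Space (n + 1) => inner ℝ p (lcScale n e)).HasTemperateGrowth := by fun_prop
  rw [h1, h1, SchwartzMap.lineDerivOp_compCLMOfContinuousLinearEquiv,
    SchwartzMap.lineDerivOp_fourier_eq]
  congr 2
  ext p
  rw [smul_apply, SchwartzMap.smulLeftCLM_apply_apply hi,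
    SchwartzMap.smulLeftCLM_apply_apply (hasTemperateGrowth_I_mul_lcForm e), inner_lcScale,
    Complex.real_smul, smul_eq_mul, smul_eq_mul]
  have h2 : (Real.pi : ℂ) ≠ 0 := by exact_mod_cast Real.pi_ne_zero
  push_cast
  field_simp

lemma lcForm_single_zero (p : Space (n + 1)) :
    lcForm p (EuclideanSpace.single 0 1) = p (Fin.last n) := by
  have h : Fin.last n ≠ 0 := Fin.last_pos'.ne'
  have h1 : ∀ i ∈ Finset.univ.filter (fun i : Fin n => i ≠ 0),
      p i.castSucc * (EuclideanSpace.single (0 : Fin (n + 1)) (1 : ℝ)) i.castSucc = 0 := by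
    intro i hi
    have : i ≠ 0 := by simpa using hi
    simp [this]
  rw [lcForm, Finset.sum_eq_zero h1]
  simp [h]

lemma lcForm_single_last (p : Space (n + 1)) :
    lcForm p (EuclideanSpace.single (Fin.last n) 1) = p 0 := by
  have h : (0 : Fin (n + 1)) ≠ Fin.last n := Fin.last_pos'.ne
  have h1 : ∀ i ∈ Finset.univ.filter (fun i : Fin n => i ≠ 0),
      p i.castSucc * (EuclideanSpace.single (Fin.last n) (1 : ℝ)) i.castSucc = 0 := by
    intro i _
    simp [(Fin.castSucc_lt_last i).ne]
  rw [lcForm, Finset.sum_eq_zero h1]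
  simp [h]

lemma lcForm_single_castSucc (p : Space (n + 1)) {i : Fin n} (hi : i ≠ 0) :
    lcForm p (EuclideanSpace.single i.castSucc 1) = -p i.castSucc := by
  have h0 : (0 : Fin (n + 1)) ≠ i.castSucc := by
    rw [← Fin.castSucc_zero']
    exact fun h => hi (Fin.castSucc_injective n h).symm
  rw [lcForm, Finset.sum_eq_single_of_mem i (by simpa using hi)]
  · simp [h0, (Fin.castSucc_lt_last i).ne']
  · intro j _ hj
    simp [hj]

/-- Each second derivative contributes `i² = -1`, while the `m²` term has no such factor; hence the
overall minus sign. -/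
lemma lcFourier_massPoly (m : ℝ) (f : 𝓢(Space (n + 1), ℂ)) :
    (2 : ℂ) • ∂_{EuclideanSpace.single (Fin.last n) (1 : ℝ)}
        (∂_{EuclideanSpace.single (0 : Fin (n + 1)) (1 : ℝ)} (lcFourier n f))
      - ∑ i : Fin n with i ≠ 0, ∂_{EuclideanSpace.single i.castSucc (1 : ℝ)}
          (∂_{EuclideanSpace.single i.castSucc (1 : ℝ)} (lcFourier n f))
      + ((m ^ 2 : ℝ) : ℂ) • lcFourier n f =
    -lcFourier n (SchwartzMap.smulLeftCLM ℂ (massPoly m) f) := by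
  simp only [lineDerivOp_lcFourier]
  rw [← map_smul (lcFourier n) (2 : ℂ), ← map_sum, ← map_sub,
    ← map_smul (lcFourier n) ((m ^ 2 : ℝ) : ℂ), ← map_add, ← map_neg]
  congr 1
  ext p
  have hs : ∀ i ∈ Finset.univ.filter (fun i : Fin n => i ≠ 0),
      SchwartzMap.smulLeftCLM ℂ (fun p : Space (n + 1) =>
          Complex.I * (lcForm p (EuclideanSpace.single i.castSucc 1) : ℂ))
        (SchwartzMap.smulLeftCLM ℂ (fun p : Space (n + 1) =>
          Complex.I * (lcForm p (EuclideanSpace.single i.castSucc 1) : ℂ)) f) p =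
      -(((p i.castSucc * p i.castSucc : ℝ) : ℂ) * f p) := by
    intro i hi
    have hi' : i ≠ 0 := by simpa using hi
    rw [SchwartzMap.smulLeftCLM_apply_apply (hasTemperateGrowth_I_mul_lcForm _),
      SchwartzMap.smulLeftCLM_apply_apply (hasTemperateGrowth_I_mul_lcForm _),
      lcForm_single_castSucc p hi', smul_eq_mul, smul_eq_mul]
    push_cast
    linear_combination ((p i.castSucc : ℂ) ^ 2 * f p) * Complex.I_sq
  simp only [add_apply, sub_apply, smul_apply, sum_apply, neg_apply]
  rw [Finset.sum_congr rfl hs, SchwartzMap.smulLeftCLM_apply_apply (hasTemperateGrowth_massPoly m),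
    SchwartzMap.smulLeftCLM_apply_apply (hasTemperateGrowth_I_mul_lcForm _),
    SchwartzMap.smulLeftCLM_apply_apply (hasTemperateGrowth_I_mul_lcForm _),
    lcForm_single_zero, lcForm_single_last]
  simp only [massPoly, lcForm, smul_eq_mul, Finset.sum_neg_distrib, ← Finset.sum_mul]
  push_cast
  linear_combination (2 * (p 0 : ℂ) * p (Fin.last n) * f p) * Complex.I_sq

lemma massMul_apply (m : ℝ) (v : 𝓢'(Space (n + 1), ℂ)) (f : 𝓢(Space (n + 1), ℂ)) :
    massMul m v f = v (SchwartzMap.smulLeftCLM ℂ (massPoly m) f) := rfl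

lemma lcFourierDist_apply (u : 𝓢'(Space (n + 1), ℂ)) (f : 𝓢(Space (n + 1), ℂ)) :
    lcFourierDist u f = u (lcFourier n f) := rfl

lemma lcFourierInvDist_apply (u : 𝓢'(Space (n + 1), ℂ)) (f : 𝓢(Space (n + 1), ℂ)) :
    lcFourierInvDist u f = u ((lcFourier n).symm f) := rfl

/-- The operator is of pure second order, so the signs from the two integrations by parts cancel. -/
lemma lcBox_apply (u : 𝓢'(Space (n + 1), ℂ)) (f : 𝓢(Space (n + 1), ℂ)) :
    lcBox u f = u ((2 : ℂ) • ∂_{EuclideanSpace.single (Fin.last n) (1 : ℝ)}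
        (∂_{EuclideanSpace.single (0 : Fin (n + 1)) (1 : ℝ)} f)
      - ∑ i : Fin n with i ≠ 0, ∂_{EuclideanSpace.single i.castSucc (1 : ℝ)}
          (∂_{EuclideanSpace.single i.castSucc (1 : ℝ)} f)) := by
  have h : ∀ a b : Space (n + 1), (∂_{a} (∂_{b} u)) f = u (∂_{b} (∂_{a} f)) := by
    intro a b
    rw [TemperedDistribution.lineDerivOp_apply_apply, TemperedDistribution.lineDerivOp_apply_apply,
      LineDeriv.lineDerivOp_neg, neg_neg]
  rw [lcBox, sub_apply, smul_apply, sum_apply, h, map_sub, map_smul, map_sum]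
  simp only [h]

lemma massMul_lcFourierDist {m : ℝ} {u : 𝓢'(Space (n + 1), ℂ)}
    (hu : lcBox u + ((m ^ 2 : ℝ) : ℂ) • u = 0) : massMul m (lcFourierDist u) = 0 := by
  ext f
  have h1 : (lcBox u + ((m ^ 2 : ℝ) : ℂ) • u) (lcFourier n f) = 0 := by rw [hu]; rfl
  rw [add_apply, smul_apply, lcBox_apply, ← map_smul, ← map_add, lcFourier_massPoly, map_neg,
    neg_eq_zero] at h1
  exact h1

lemma lcFourierInvDist_lcFourierDist (u : 𝓢'(Space (n + 1), ℂ)) :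
    lcFourierInvDist (lcFourierDist u) = u := by
  ext f
  rw [lcFourierInvDist_apply, lcFourierDist_apply, ContinuousLinearEquiv.apply_symm_apply]

lemma lcFourierDist_lcFourierInvDist (u : 𝓢'(Space (n + 1), ℂ)) :
    lcFourierDist (lcFourierInvDist u) = u := by
  ext f
  rw [lcFourierDist_apply, lcFourierInvDist_apply, ContinuousLinearEquiv.symm_apply_apply]

end Fourier

/-! ### Existence, uniqueness and splitting of the density on the shell -/

section Solutions

variable {n : ℕ} [NeZero n] {m : ℝ}

lemma squeezed_zero_apply (p : Space n) : (0 : SqueezedSchwartz n) p = 0 := rfl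

lemma squeezed_add_apply (f g : SqueezedSchwartz n) (p : Space n) : (f + g) p = f p + g p := rfl

lemma delta_apply (hm : m ≠ 0) (b : SqueezedDist n) (f : 𝓢(Space (n + 1), ℂ)) :
    delta hm b f = b (onShellCLM hm (fun _ => 1) f) := rfl

lemma delta_injective (hm : m ≠ 0) : Function.Injective (delta (n := n) hm) := by
  intro b b' h
  ext g
  have h1 : delta hm b (onShellSection hm g) = delta hm b' (onShellSection hm g) := by rw [h]
  rwa [delta_apply, delta_apply, onShellCLM_onShellSection] at h1

lemma onShellCLM_massPoly (hm : m ≠ 0) (θ : SignType → ℝ) (f : 𝓢(Space (n + 1), ℂ)) :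
    onShellCLM hm θ (SchwartzMap.smulLeftCLM ℂ (massPoly m) f) = 0 := by
  refine SqueezedSchwartz.ext fun p => ?_
  rw [onShellCLM_apply, onShell]
  rw [squeezed_zero_apply]
  split_ifs with hp
  · rfl
  · rw [SchwartzMap.smulLeftCLM_apply_apply (hasTemperateGrowth_massPoly m), massPoly_eq,
      massReal_shellPoint hp]
    simp

lemma massMul_delta (hm : m ≠ 0) (b : SqueezedDist n) : massMul m (delta hm b) = 0 := by
  ext f
  rw [massMul_apply, delta_apply, onShellCLM_massPoly, map_zero]
  rfl

lemma massMul_deltaPos_add_deltaNeg (hm : m ≠ 0) (bp bm : SqueezedDist n) :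
    massMul m (deltaPos hm bp + deltaNeg hm bm) = 0 := by
  ext f
  change bp (onShellCLM hm _ (SchwartzMap.smulLeftCLM ℂ (massPoly m) f)) +
    bm (onShellCLM hm _ (SchwartzMap.smulLeftCLM ℂ (massPoly m) f)) = 0
  rw [onShellCLM_massPoly, onShellCLM_massPoly, map_zero, map_zero, add_zero]

lemma exists_eq_delta (hm : m ≠ 0) {v : 𝓢'(Space (n + 1), ℂ)} (hv : massMul m v = 0) :
    ∃ b : SqueezedDist n, v = delta hm b := by
  -- The density is `v` evaluated on extensions. A test function and the extension of its
  -- restriction agree on the shell, so their difference is annihilated by `v`.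
  refine ⟨PointwiseConvergenceCLM.precomp ℂ (onShellSection hm) v, ?_⟩
  ext f
  change v f = v (onShellSection hm (onShellCLM hm (fun _ => 1) f))
  rw [← sub_eq_zero, ← map_sub]
  refine apply_eq_zero_of_vanish_on_shell hm v (fun g => ?_) _ fun p hp => ?_
  · change massMul m v g = 0
    rw [hv]
    rfl
  · have h1 : onShellCLM hm (fun _ => 1)
        (f - onShellSection hm (onShellCLM hm (fun _ => 1) f)) = 0 := by
      rw [map_sub, onShellCLM_onShellSection, sub_self]
    have h2 : onShellCLM hm _ _ p = (0 : SqueezedSchwartz n) p := congrArg (fun g => g p) h1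
    rw [onShellCLM_apply, squeezed_zero_apply, onShell, if_neg hp] at h2
    refine (mul_eq_zero.1 h2).resolve_left ?_
    have := abs_pos.2 hp
    exact_mod_cast (by positivity : (1 : ℝ) / (2 * |p 0|) ≠ 0)

/-- Restriction of a squeezed generalized function by a function of the sign of `p^+`. -/
def signMulDist (hm : m ≠ 0) (η : SignType → ℝ) (b : SqueezedDist n) : SqueezedDist n :=
  PointwiseConvergenceCLM.precomp ℂ (signMul hm η) b

lemma signMulDist_mem_pos (hm : m ≠ 0) (b : SqueezedDist n) :
    signMulDist hm (fun s => if s = 1 then 1 else 0) b ∈ posSqueezedDist n := by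
  intro f hf
  change b (signMul hm _ f) = 0
  have h : signMul hm (fun s => if s = 1 then 1 else 0) f = 0 := by
    refine SqueezedSchwartz.ext fun p => ?_
    rw [signMul_apply, squeezed_zero_apply]
    split_ifs with hp
    · rw [hf p (sign_eq_one_iff.1 hp), mul_zero]
    · simp
  rw [h, map_zero]

lemma signMulDist_mem_neg (hm : m ≠ 0) (b : SqueezedDist n) :
    signMulDist hm (fun s => if s = -1 then 1 else 0) b ∈ negSqueezedDist n := by
  intro f hf
  change b (signMul hm _ f) = 0
  have h : signMul hm (fun s => if s = -1 then 1 else 0) f = 0 := by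
    refine SqueezedSchwartz.ext fun p => ?_
    rw [signMul_apply, squeezed_zero_apply]
    split_ifs with hp
    · rw [hf p (sign_eq_neg_one_iff.1 hp), mul_zero]
    · simp
  rw [h, map_zero]

/-- Pointwise this is `Θ(p^+)² + Θ(-p^+)² = 1` for `p^+ ≠ 0`; at `p^+ = 0` every term vanishes. -/
lemma delta_eq_deltaPos_add_deltaNeg (hm : m ≠ 0) (b : SqueezedDist n) :
    delta hm b = deltaPos hm (signMulDist hm (fun s => if s = 1 then 1 else 0) b) +
      deltaNeg hm (signMulDist hm (fun s => if s = -1 then 1 else 0) b) := by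
  ext f
  change b (onShellCLM hm _ f) = b (signMul hm _ (onShellCLM hm _ f)) +
    b (signMul hm _ (onShellCLM hm _ f))
  rw [← map_add]
  congr 1
  refine SqueezedSchwartz.ext fun p => ?_
  rw [squeezed_add_apply, onShellCLM_apply, signMul_apply, signMul_apply, onShellCLM_apply, onShellCLM_apply, onShell, onShell, onShell]
  by_cases hp : p 0 = 0
  · simp [hp]
  · rcases lt_or_gt_of_ne hp with h | h
    · simp [hp, sign_neg h]
    · simp [hp, sign_pos h]

end Solutions

end LightCone

end

open LightCone in
theorem mainTheorem4 (n : ℕ) [NeZero n] (m : ℝ) (hm : 0 < m) :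
    (∀ u : 𝓢'(Space (n + 1), ℂ), lcBox u + ((m ^ 2 : ℝ) : ℂ) • u = 0 →
      ∃! b : SqueezedDist n, u = lcFourierInvDist (delta hm.ne' b)) ∧
    (∀ v : 𝓢'(Space (n + 1), ℂ), massMul m v = 0 ↔
      ∃ bp ∈ posSqueezedDist n, ∃ bm ∈ negSqueezedDist n,
        v = deltaPos hm.ne' bp + deltaNeg hm.ne' bm) ∧
    (∀ v : 𝓢'(Space (n + 1), ℂ), massMul m v = 0 ↔
      ∃ b : SqueezedDist n, v = delta hm.ne' b) := by
  refine ⟨fun u hu => ?_, fun v => ⟨fun hv => ?_, ?_⟩, fun v => ⟨exists_eq_delta hm.ne', ?_⟩⟩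
  · obtain ⟨b, hb⟩ := exists_eq_delta hm.ne' (massMul_lcFourierDist hu)
    refine ⟨b, ?_, fun b' hb' => delta_injective hm.ne' ?_⟩
    · change u = lcFourierInvDist (delta hm.ne' b)
      rw [← hb, lcFourierInvDist_lcFourierDist]
    -- Any competing density has the same `delta`, namely the Fourier transform of `u`.
    · rw [← hb, hb', lcFourierDist_lcFourierInvDist]
  · obtain ⟨b, rfl⟩ := exists_eq_delta hm.ne' hv
    exact ⟨_, signMulDist_mem_pos hm.ne' b, _, signMulDist_mem_neg hm.ne' b,
      delta_eq_deltaPos_add_deltaNeg hm.ne' b⟩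
  · rintro ⟨bp, -, bm, -, rfl⟩
    exact massMul_deltaPos_add_deltaNeg hm.ne' bp bm
  · rintro ⟨b, rfl⟩
    exact massMul_delta hm.ne' b
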